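/- Let $F$ be an arbitrary field and let $(S,n)$ be a quadratic space of dimension $8$ over $F$ whose polar form $b_n(x,y)=n(x+y)-n(x)-n(y)$ has radical $\{0\}$. Let $\star$ be a symmetric composition on $(S,n)$, i.e. an $F$-bilinear map $S\times S\to S$ such that, for some $\lambda_\star\in F^\times$, $n(x\star y)=\lambda_\star n(x)n(y)$ for all $x,y$, and $b_n(x\star y,z)=b_n(x,y\star z)$ for all $x,y,z$. Let $\star^{\mathrm{op}}$ be the opposite composition, $x\star^{\mathrm{op}}y=y\star x$. For a commutative $F$-algebra $R$ write $S_R=R\otimes_F S$, and extend $n$ and $\star$ to $S_R$. Let $\mathbf{GO}^+(n)$ be the algebraic group of proper similarities: $\mathbf{GO}^+(n)(R)$ consists of the $R$-linear bijections $f$ of $S_R$ with $n(f(x))=\mu(f)n(x)$ for some $\mu(f)\in R^\times$, such that the induced automorphism $C_0(f)\colon xy\mapsto\mu(f)^{-1}f(x)f(y)$ of the even Clifford algebra $C_0(S_R,n)$ fixes its center. Let $\mathbf{PGO}^+(n)=\mathbf{GO}^+(n)/\mathbf{G}_m$, whose $R$-points are the automorphisms of the $R$-algebra $\operatorname{End}_R(S_R)$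 that are, locally for the fppf topology, of the form $[f]\colon\varphi\mapsto f\varphi f^{-1}$ with $f$ a proper similarity. Let $\alpha_0^\star\colon C_0(S_R,n)\to \operatorname{End}_R(S_R)\times\operatorname{End}_R(S_R)$ be the $R$-algebra homomorphism with $\alpha_0^\star(xy)=(\lambda_\star^{-1}r_x\ell_y,\ \lambda_\star^{-1}\ell_x r_y)$, where $\ell_x(z)=x\star z$ and $r_x(z)=z\star x$. Then there is a well-defined map $\rho_\star$ of $\mathbf{PGO}^+(n)$ to itself, given on $R$-points as follows: $\rho_\star(\varphi)$ is the unique $\psi\in\mathbf{PGO}^+(n)(R)$ such that, locally for the fppf topology, $\varphi=[f]$ and $\psi=[g]$ for proper similarities $f$, $g$ for which there is a proper similarity $h$ with $$\alpha_0^\star\circ C_0(f)=(\operatorname{Int}[g]\times\operatorname{Int}[h])\circ\alpha_0^\star .$$ In particular $\rho_\star[f]=[g]$ whenever $f,g,h\in\mathbf{GO}^+(n)(R)$ and there is $c\in R^\times$ with $c\,f(x\star y)=g(x)\star h(y)$ for all $x,y\in S_R$. The map $\rho_\star$ is an automorphism of the algebraic group $\mathbf{PGO}^+(n)$ that is outer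 (it is not conjugation by a rational point, neither over $F$ nor over any field extension of $F$) and has order exactly $3$, and $$\rho_\star^{-1}=\rho_{\star^{\mathrm{op}}}.$$ -/

import Mathlib

open TensorProduct CategoryTheory

universe u v

namespace Triality

noncomputable section

/-- The algebra map between even Clifford algebras induced by a linear map `T`, over a change of
scalars `A → A'`, that carries the form `Q` to `Q'`: `x y ↦ T(x) T(y)`. -/
def evenMap {A A' M M' : Type*} [CommRing A] [CommRing A'] [Algebra A A']
    [AddCommGroup M] [AddCommGroup M'] [Module A M] [Module A M'] [Module A' M'] [IsScalarTower A A' M']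
    (Q : QuadraticForm A M) (Q' : QuadraticForm A' M') (T : M →ₗ[A] M')
    (hT : ∀ m, Q' (T m) = algebraMap A A' (Q m)) :
    CliffordAlgebra.even Q →ₐ[A] CliffordAlgebra.even Q' :=
  CliffordAlgebra.even.lift Q
    { bilin := LinearMap.mk₂ A
        (fun x y => (CliffordAlgebra.even.ι Q').bilin (T x) (T y))
        (fun x x' y => by simp)
        (fun c x y => by
          rw [map_smul, ← algebraMap_smul A' c (T x), map_smul, LinearMap.smul_apply,
            algebraMap_smul])
        (fun x y y' => by simp)
        (fun c x y => by
          rw [map_smul, ← algebraMap_smul A' c (T y), map_smul, algebraMap_smul])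
      contract := fun m => by
        have h := (CliffordAlgebra.even.ι Q').contract (T m)
        rw [LinearMap.mk₂_apply, h, hT, ← IsScalarTower.algebraMap_apply]
      contract_mid := fun m₁ m₂ m₃ => by
        have h := (CliffordAlgebra.even.ι Q').contract_mid (T m₁) (T m₂) (T m₃)
        rw [hT, algebraMap_smul] at h
        exact h }

theorem evenMap_bilin {A A' M M' : Type*} [CommRing A] [CommRing A'] [Algebra A A']
    [AddCommGroup M] [AddCommGroup M'] [Module A M] [Module A M'] [Module A' M'] [IsScalarTower A A' M']
    (Q : QuadraticForm A M) (Q' : QuadraticForm A' M') (T : M →ₗ[A] M')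
    (hT : ∀ m, Q' (T m) = algebraMap A A' (Q m)) (x y : M) :
    evenMap Q Q' T hT ((CliffordAlgebra.even.ι Q).bilin x y) =
      (CliffordAlgebra.even.ι Q').bilin (T x) (T y) := by
  simp [evenMap]

section Forms

variable {F : Type u} [Field F] {S : Type v} [AddCommGroup S] [Module F S]

/-- An `F`-bilinear form `B`, not symmetric in general, with `B x x = n x` for all `x`. -/
def lower (n : QuadraticForm F S) : LinearMap.BilinForm F S :=
  Classical.choose (LinearMap.BilinMap.toQuadraticMap_surjective n)

theorem lower_self (n : QuadraticForm F S) (x : S) : lower n x x = n x := by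
  have h := Classical.choose_spec (LinearMap.BilinMap.toQuadraticMap_surjective n)
  exact congrArg (fun q : QuadraticForm F S => q x) h

/-- The quadratic form `n_R` on `R ⊗ S`: the extension of scalars of `n`, in arbitrary
characteristic.  It is the unique `R`-quadratic form with `n_R (1 ⊗ x) = n x`, see `scalar_tmul`
and `scalar_unique`. -/
def scalar (n : QuadraticForm F S) (R : Type u) [CommRing R] [Algebra F R] :
    QuadraticForm R (R ⊗[F] S) :=
  ((lower n).baseChange R).toQuadraticMap

variable (n : QuadraticForm F S)
variable (R : Type u) [CommRing R] [Algebra F R]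
variable {R₁ : Type u} [CommRing R₁] [Algebra F R₁] {R₂ : Type u} [CommRing R₂] [Algebra F R₂]

theorem scalar_tmul (r : R) (x : S) : scalar n R (r ⊗ₜ x) = r ^ 2 * algebraMap F R (n x) := by
  simp only [scalar, LinearMap.BilinMap.toQuadraticMap_apply,
    LinearMap.BilinForm.baseChange_tmul, lower_self, Algebra.smul_def]
  ring

theorem scalar_unique (Q : QuadraticForm R (R ⊗[F] S))
    (h : ∀ x : S, Q (1 ⊗ₜ x) = algebraMap F R (n x)) : Q = scalar n R := by
  apply baseChange_ext
  intro x
  simp [h, scalar_tmul]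

/-- The map `R₁ ⊗ S → R₂ ⊗ S` induced by a homomorphism `R₁ → R₂`. -/
def push (S : Type v) [AddCommGroup S] [Module F S] (w : R₁ →ₐ[F] R₂) :
    R₁ ⊗[F] S →ₗ[F] R₂ ⊗[F] S :=
  LinearMap.rTensor S w.toLinearMap

@[simp] theorem push_tmul (w : R₁ →ₐ[F] R₂) (r : R₁) (x : S) :
    push S w (r ⊗ₜ x) = w r ⊗ₜ x := by
  simp [push]

theorem push_smul (w : R₁ →ₐ[F] R₂) (r : R₁) (x : R₁ ⊗[F] S) :
    push S w (r • x) = w r • push S w x := by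
  induction x with
  | zero => simp
  | tmul s x => simp [TensorProduct.smul_tmul']
  | add x y hx hy => simp [smul_add, hx, hy]

theorem scalar_push (w : R₁ →ₐ[F] R₂) (x : R₁ ⊗[F] S) :
    scalar n R₂ (push S w x) = w (scalar n R₁ x) := by
  have key : ∀ x y : R₁ ⊗[F] S, (lower n).baseChange R₂ (push S w x) (push S w y)
      = w ((lower n).baseChange R₁ x y) := by
    intro x y
    induction x with
    | zero => simp
    | add x x' hx hx' => simp only [map_add, LinearMap.add_apply, hx, hx']
    | tmul r x =>
      induction y with
      | zero => simp
      | add y y' hy hy' => simp only [map_add, hy, hy']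
      | tmul s y => simp [LinearMap.BilinForm.baseChange_tmul]
  simpa [scalar] using key x x

/-- A similarity of `(R ⊗ S, n_R)`, with its multiplier. These are the `R`-points of `GO(n)`. -/
structure Similitude where
  toEquiv : (R ⊗[F] S) ≃ₗ[R] (R ⊗[F] S)
  mult : Rˣ
  map_form : ∀ x, scalar n R (toEquiv x) = (mult : R) * scalar n R x

/-- The even Clifford algebra of `(R ⊗ S, n_R)`. -/
abbrev C0 : Subalgebra R (CliffordAlgebra (scalar n R)) := CliffordAlgebra.even (scalar n R)

variable {n R}

/-- The automorphism `C₀(f)` of the even Clifford algebra: `x y ↦ μ(f)⁻¹ f(x) f(y)`. -/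
def Similitude.mapC0 (f : Similitude n R) : C0 n R →ₐ[R] C0 n R :=
  CliffordAlgebra.even.lift (scalar n R)
    { bilin := ((f.mult⁻¹ : Rˣ) : R) • (CliffordAlgebra.even.ι (scalar n R)).bilin.compl₁₂
        f.toEquiv.toLinearMap f.toEquiv.toLinearMap
      contract := fun m => by
        have h := (CliffordAlgebra.even.ι (scalar n R)).contract (f.toEquiv m)
        simp only [LinearMap.smul_apply, LinearMap.compl₁₂_apply, LinearEquiv.coe_coe, h,
          f.map_form]
        rw [Algebra.smul_def, ← map_mul, Units.inv_mul_cancel_left]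
      contract_mid := fun m₁ m₂ m₃ => by
        have h := (CliffordAlgebra.even.ι (scalar n R)).contract_mid
          (f.toEquiv m₁) (f.toEquiv m₂) (f.toEquiv m₃)
        simp only [LinearMap.smul_apply, LinearMap.compl₁₂_apply, LinearEquiv.coe_coe,
          smul_mul_assoc, mul_smul_comm, h, f.map_form, smul_smul]
        congr 1
        linear_combination (scalar n R m₂ * ((f.mult⁻¹ : Rˣ) : R)) * f.mult.inv_mul }

theorem Similitude.mapC0_bilin (f : Similitude n R) (x y : R ⊗[F] S) :
    f.mapC0 ((CliffordAlgebra.even.ι (scalar n R)).bilin x y) =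
      ((f.mult⁻¹ : Rˣ) : R) •
        (CliffordAlgebra.even.ι (scalar n R)).bilin (f.toEquiv x) (f.toEquiv y) := by
  simp [mapC0]

variable (n R) in
/-- The canonical `F`-algebra map from the even Clifford algebra `C₀(S, n)` to that of
`(R ⊗ S, n_R)`, with `x y ↦ (1 ⊗ x) (1 ⊗ y)`. It identifies the latter algebra with
`R ⊗ C₀(S, n)`. -/
def inclC0 : CliffordAlgebra.even n →ₐ[F] C0 n R :=
  evenMap n (scalar n R) (TensorProduct.mk F R S 1) fun m => by
    rw [TensorProduct.mk_apply, scalar_tmul, one_pow, one_mul]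

theorem inclC0_bilin (x y : S) :
    inclC0 n R ((CliffordAlgebra.even.ι n).bilin x y) =
      (CliffordAlgebra.even.ι (scalar n R)).bilin (1 ⊗ₜ x) (1 ⊗ₜ y) :=
  evenMap_bilin ..

/-- A similarity is proper if `C₀(f)` fixes the center of the even Clifford algebra. As
`C₀(R ⊗ S, n_R) = R ⊗ C₀(S, n)`, that center is spanned over `R` by the image of the center of
`C₀(S, n)`. The proper similarities are the `R`-points of `GO⁺(n)`. -/
def Similitude.Proper (f : Similitude n R) : Prop :=
  ∀ z ∈ Subalgebra.center F (CliffordAlgebra.even n), f.mapC0 (inclC0 n R z) = inclC0 n R z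

/-! ### Composition of similarities and extension of scalars -/

def Similitude.one : Similitude n R where
  toEquiv := LinearEquiv.refl R _
  mult := 1
  map_form := by simp

def Similitude.mul (f g : Similitude n R) : Similitude n R where
  toEquiv := g.toEquiv.trans f.toEquiv
  mult := f.mult * g.mult
  map_form := fun x => by simp [f.map_form, g.map_form, mul_assoc]

def Similitude.inv (f : Similitude n R) : Similitude n R where
  toEquiv := f.toEquiv.symm
  mult := f.mult⁻¹
  map_form := fun x => by
    have h := f.map_form (f.toEquiv.symm x)
    rw [LinearEquiv.apply_symm_apply] at h
    rw [h, Units.inv_mul_cancel_left]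

theorem Similitude.mapC0_one : (Similitude.one : Similitude n R).mapC0 = AlgHom.id R _ := by
  apply CliffordAlgebra.even.algHom_ext
  apply CliffordAlgebra.EvenHom.ext
  refine LinearMap.ext₂ fun x y => ?_
  simp [mapC0_bilin, one]

theorem Similitude.mapC0_mul (f g : Similitude n R) :
    (f.mul g).mapC0 = f.mapC0.comp g.mapC0 := by
  apply CliffordAlgebra.even.algHom_ext
  apply CliffordAlgebra.EvenHom.ext
  refine LinearMap.ext₂ fun x y => ?_
  simp [mapC0_bilin, mul, smul_smul]

theorem Similitude.Proper.one : (Similitude.one : Similitude n R).Proper := by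
  intro z _
  rw [mapC0_one]; rfl

theorem Similitude.Proper.mul {f g : Similitude n R} (hf : f.Proper) (hg : g.Proper) :
    (f.mul g).Proper := by
  intro z hz
  rw [mapC0_mul, AlgHom.comp_apply, hg z hz, hf z hz]

theorem Similitude.Proper.inv {f : Similitude n R} (hf : f.Proper) : f.inv.Proper := by
  intro z hz
  have h : (f.inv.mul f) = Similitude.one := by
    simp [Similitude.mul, Similitude.inv, Similitude.one]
  conv_lhs => rw [← hf z hz]
  rw [← AlgHom.comp_apply, ← mapC0_mul, h, mapC0_one]; rfl

/-- Extension of scalars of an endomorphism along `R₁ → R₂`. -/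
def pushEnd (w : R₁ →ₐ[F] R₂) (f : R₁ ⊗[F] S →ₗ[R₁] R₁ ⊗[F] S) :
    R₂ ⊗[F] S →ₗ[R₂] R₂ ⊗[F] S :=
  LinearMap.liftBaseChange R₂
    ((push S w ∘ₗ f.restrictScalars F) ∘ₗ TensorProduct.mk F R₁ S 1)

theorem pushEnd_push (w : R₁ →ₐ[F] R₂) (f : R₁ ⊗[F] S →ₗ[R₁] R₁ ⊗[F] S) (x : R₁ ⊗[F] S) :
    pushEnd w f (push S w x) = push S w (f x) := by
  induction x with
  | zero => simp
  | add x y hx hy => simp only [map_add, hx, hy]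
  | tmul r x =>
    have h : r ⊗ₜ[F] x = r • ((1 : R₁) ⊗ₜ[F] x) := by simp [TensorProduct.smul_tmul']
    rw [push_tmul, pushEnd, LinearMap.liftBaseChange_tmul]
    simp only [LinearMap.comp_apply, TensorProduct.mk_apply, LinearMap.restrictScalars_apply]
    rw [h, map_smul, push_smul]

/-- Two `R₂`-linear maps that agree on the image of `R₁ ⊗ S` are equal. -/
theorem push_ext {N : Type*} [AddCommGroup N] [Module R₂ N] (w : R₁ →ₐ[F] R₂)
    {f g : R₂ ⊗[F] S →ₗ[R₂] N} (h : ∀ x, f (push S w x) = g (push S w x)) : f = g := by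
  apply LinearMap.ext
  intro y
  induction y with
  | zero => simp
  | add x y hx hy => simp only [map_add, hx, hy]
  | tmul r x =>
    have e : r ⊗ₜ[F] x = r • push S w ((1 : R₁) ⊗ₜ[F] x) := by simp [TensorProduct.smul_tmul']
    rw [e, map_smul, map_smul, h]

/-- Extension of scalars of a similarity along `R₁ → R₂`. -/
def Similitude.base (w : R₁ →ₐ[F] R₂) (f : Similitude n R₁) : Similitude n R₂ where
  toEquiv := LinearEquiv.ofLinearMap (pushEnd w f.toEquiv.toLinearMap)
    (pushEnd w f.toEquiv.symm.toLinearMap)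
    (push_ext w fun x => by simp [pushEnd_push]) (push_ext w fun x => by simp [pushEnd_push])
  mult := Units.map (w : R₁ →* R₂) f.mult
  map_form := fun x => by
    have h : (scalar n R₂).comp (pushEnd w f.toEquiv.toLinearMap) =
        w (f.mult : R₁) • scalar n R₂ := by
      apply baseChange_ext
      intro m
      have e : (1 : R₂) ⊗ₜ[F] m = push S w (1 ⊗ₜ m) := by simp
      rw [QuadraticMap.comp_apply, e, pushEnd_push, scalar_push, LinearEquiv.coe_coe, f.map_form,
        smul_apply, scalar_push, map_mul, smul_eq_mul]
    exact congrArg (fun q : QuadraticForm R₂ (R₂ ⊗[F] S) => q x) h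

theorem Similitude.base_push (w : R₁ →ₐ[F] R₂) (f : Similitude n R₁) (x : R₁ ⊗[F] S) :
    (f.base w).toEquiv (push S w x) = push S w (f.toEquiv x) :=
  pushEnd_push w f.toEquiv.toLinearMap x

theorem exists_pushC0 (w : R₁ →ₐ[F] R₂) :
    ∃ j : C0 n R₁ →+* C0 n R₂,
      (∀ r c, j (r • c) = w r • j c) ∧
      ∀ x y, j ((CliffordAlgebra.even.ι (scalar n R₁)).bilin x y) =
        (CliffordAlgebra.even.ι (scalar n R₂)).bilin (push S w x) (push S w y) := by
  let _ : Algebra R₁ R₂ := w.toRingHom.toAlgebra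
  have hw : ∀ r : R₁, algebraMap R₁ R₂ r = w r := fun _ => rfl
  let T : R₁ ⊗[F] S →ₗ[R₁] R₂ ⊗[F] S :=
    { toFun := push S w
      map_add' := map_add _
      map_smul' := fun c x => by rw [push_smul, RingHom.id_apply, ← hw, algebraMap_smul] }
  let j := evenMap (scalar n R₁) (scalar n R₂) T fun m => scalar_push n w m
  refine ⟨j.toRingHom, fun r c => ?_, fun x y => ?_⟩
  · change j (r • c) = w r • j c
    rw [map_smul, ← hw, algebraMap_smul]
  · change j _ = _
    exact evenMap_bilin ..

theorem Similitude.Proper.base (w : R₁ →ₐ[F] R₂) {f : Similitude n R₁} (hf : f.Proper) :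
    (f.base w).Proper := by
  obtain ⟨j, hj, hj'⟩ := exists_pushC0 (n := n) w
  have hF : ∀ (r : F) c, j (r • c) = r • j c := fun r c => by
    rw [← algebraMap_smul R₁ r c, hj, AlgHom.commutes, algebraMap_smul]
  let jF : C0 n R₁ →ₐ[F] C0 n R₂ := AlgHom.mk' j hF
  have hincl : ∀ z, j (inclC0 n R₁ z) = inclC0 n R₂ z := by
    have : jF.comp (inclC0 n R₁) = inclC0 n R₂ := by
      apply CliffordAlgebra.even.algHom_ext
      apply CliffordAlgebra.EvenHom.ext
      refine LinearMap.ext₂ fun x y => ?_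
      change j (inclC0 n R₁ ((CliffordAlgebra.even.ι n).bilin x y)) =
        inclC0 n R₂ ((CliffordAlgebra.even.ι n).bilin x y)
      rw [inclC0_bilin, inclC0_bilin, hj', push_tmul, push_tmul, map_one]
    exact fun z => congrArg (fun q : CliffordAlgebra.even n →ₐ[F] C0 n R₂ => q z) this
  have hC0 : ∀ z : CliffordAlgebra.even n,
      j (f.mapC0 (inclC0 n R₁ z)) = (f.base w).mapC0 (inclC0 n R₂ z) := by
    have : (jF.comp (f.mapC0.restrictScalars F)).comp (inclC0 n R₁) =
        ((f.base w).mapC0.restrictScalars F).comp (inclC0 n R₂) := by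
      apply CliffordAlgebra.even.algHom_ext
      apply CliffordAlgebra.EvenHom.ext
      refine LinearMap.ext₂ fun x y => ?_
      change j (f.mapC0 (inclC0 n R₁ ((CliffordAlgebra.even.ι n).bilin x y))) =
        (f.base w).mapC0 (inclC0 n R₂ ((CliffordAlgebra.even.ι n).bilin x y))
      have e : ∀ m : S, (1 : R₂) ⊗ₜ[F] m = push S w (1 ⊗ₜ m) := fun m => by simp
      rw [inclC0_bilin, inclC0_bilin, mapC0_bilin, mapC0_bilin, hj, hj', e, e, base_push,
        base_push]
      congr 1
    exact fun z => congrArg (fun q : CliffordAlgebra.even n →ₐ[F] C0 n R₂ => q z) this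
  intro z hz
  rw [← hC0, hf z hz, hincl]

/-- The homomorphism `R₁ ⊗ A → R₂ ⊗ A` induced by `R₁ → R₂`. -/
def pushAlg (A : Type v) [Ring A] [Algebra F A] (w : R₁ →ₐ[F] R₂) :
    R₁ ⊗[F] A →ₐ[F] R₂ ⊗[F] A :=
  Algebra.TensorProduct.map w (AlgHom.id F A)

theorem pushAlg_smul {A : Type v} [Ring A] [Algebra F A] (w : R₁ →ₐ[F] R₂) (r : R₁)
    (a : R₁ ⊗[F] A) : pushAlg A w (r • a) = w r • pushAlg A w a := by
  induction a with
  | zero => simp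
  | tmul s x => simp [pushAlg, TensorProduct.smul_tmul']
  | add x y hx hy => simp [smul_add, hx, hy]

theorem pushAlg_ext {A : Type v} [Ring A] [Algebra F A] {N : Type*} [AddCommGroup N] [Module R₂ N]
    (w : R₁ →ₐ[F] R₂) {f g : R₂ ⊗[F] A →ₗ[R₂] N}
    (h : ∀ a, f (pushAlg A w a) = g (pushAlg A w a)) : f = g := by
  apply LinearMap.ext
  intro y
  induction y with
  | zero => simp
  | add x y hx hy => simp only [map_add, hx, hy]
  | tmul r x =>
    have e : r ⊗ₜ[F] x = r • pushAlg A w ((1 : R₁) ⊗ₜ[F] x) := by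
      simp [pushAlg, TensorProduct.smul_tmul']
    rw [e, map_smul, map_smul, h]

/-- Extension of scalars, along `R₁ → R₂`, of an endomorphism of the `R₁`-algebra `R₁ ⊗ A`. -/
def baseHom {A : Type v} [Ring A] [Algebra F A] (w : R₁ →ₐ[F] R₂)
    (φ : R₁ ⊗[F] A →ₐ[R₁] R₁ ⊗[F] A) : R₂ ⊗[F] A →ₐ[R₂] R₂ ⊗[F] A :=
  Algebra.TensorProduct.lift (Algebra.ofId R₂ _)
    (((pushAlg A w).comp (φ.restrictScalars F)).comp Algebra.TensorProduct.includeRight)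
    fun r _ => Algebra.commutes r _

theorem baseHom_push {A : Type v} [Ring A] [Algebra F A] (w : R₁ →ₐ[F] R₂)
    (φ : R₁ ⊗[F] A →ₐ[R₁] R₁ ⊗[F] A) (a : R₁ ⊗[F] A) :
    baseHom w φ (pushAlg A w a) = pushAlg A w (φ a) := by
  induction a with
  | zero => simp
  | add x y hx hy => simp only [map_add, hx, hy]
  | tmul r x =>
    have h : r ⊗ₜ[F] x = r • ((1 : R₁) ⊗ₜ[F] x) := by simp [TensorProduct.smul_tmul']
    have h₁ : baseHom w φ (pushAlg A w ((1 : R₁) ⊗ₜ[F] x)) = pushAlg A w (φ (1 ⊗ₜ x)) := by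
      simp only [pushAlg, Algebra.TensorProduct.map_tmul, map_one, AlgHom.id_apply]
      change algebraMap R₂ (R₂ ⊗[F] A) 1 * pushAlg A w (φ (1 ⊗ₜ x)) = _
      rw [map_one, one_mul]
      rfl
    rw [h, pushAlg_smul, map_smul, h₁, map_smul, pushAlg_smul]

/-- Extension of scalars, along `R₁ → R₂`, of an automorphism of the `R₁`-algebra `R₁ ⊗ A`. -/
def baseAut {A : Type v} [Ring A] [Algebra F A] (w : R₁ →ₐ[F] R₂) :
    ((R₁ ⊗[F] A) ≃ₐ[R₁] (R₁ ⊗[F] A)) →* ((R₂ ⊗[F] A) ≃ₐ[R₂] (R₂ ⊗[F] A)) where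
  toFun φ := AlgEquiv.ofAlgHom (baseHom w φ) (baseHom w φ.symm)
    (AlgHom.toLinearMap_injective (pushAlg_ext w fun a => by simp [baseHom_push]))
    (AlgHom.toLinearMap_injective (pushAlg_ext w fun a => by simp [baseHom_push]))
  map_one' := by
    apply AlgEquiv.coe_toAlgHom_injective
    exact AlgHom.toLinearMap_injective (pushAlg_ext w fun a => by simp [baseHom_push])
  map_mul' φ ψ := by
    apply AlgEquiv.coe_toAlgHom_injective
    exact AlgHom.toLinearMap_injective (pushAlg_ext w fun a => by simp [baseHom_push])

theorem baseAut_push {A : Type v} [Ring A] [Algebra F A] (w : R₁ →ₐ[F] R₂)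
    (φ : (R₁ ⊗[F] A) ≃ₐ[R₁] (R₁ ⊗[F] A)) (a : R₁ ⊗[F] A) :
    baseAut w φ (pushAlg A w a) = pushAlg A w (φ a) := by
  change baseHom w (φ : R₁ ⊗[F] A →ₐ[R₁] R₁ ⊗[F] A) (pushAlg A w a) = _
  rw [baseHom_push]
  rfl

theorem aut_ext {A : Type v} [Ring A] [Algebra F A] (w : R₁ →ₐ[F] R₂)
    {φ ψ : (R₂ ⊗[F] A) ≃ₐ[R₂] (R₂ ⊗[F] A)}
    (h : ∀ a, φ (pushAlg A w a) = ψ (pushAlg A w a)) : φ = ψ := by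
  apply AlgEquiv.coe_toAlgHom_injective
  exact AlgHom.toLinearMap_injective (pushAlg_ext w h)

theorem pushAlg_comp {A : Type v} [Ring A] [Algebra F A]
    {R₃ : Type u} [CommRing R₃] [Algebra F R₃] (w : R₁ →ₐ[F] R₂) (w' : R₂ →ₐ[F] R₃)
    (a : R₁ ⊗[F] A) : pushAlg A (w'.comp w) a = pushAlg A w' (pushAlg A w a) := by
  induction a with
  | zero => simp
  | add x y hx hy => simp only [map_add, hx, hy]
  | tmul r x => simp [pushAlg]

theorem baseAut_comp {A : Type v} [Ring A] [Algebra F A]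
    {R₃ : Type u} [CommRing R₃] [Algebra F R₃] (w : R₁ →ₐ[F] R₂) (w' : R₂ →ₐ[F] R₃)
    (φ : (R₁ ⊗[F] A) ≃ₐ[R₁] (R₁ ⊗[F] A)) :
    baseAut (w'.comp w) φ = baseAut w' (baseAut w φ) :=
  aut_ext (w'.comp w) fun a => by
    rw [baseAut_push, pushAlg_comp, pushAlg_comp, baseAut_push, baseAut_push]

theorem baseAut_id {A : Type v} [Ring A] [Algebra F A]
    (φ : (R ⊗[F] A) ≃ₐ[R] (R ⊗[F] A)) : baseAut (AlgHom.id F R) φ = φ :=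
  aut_ext (AlgHom.id F R) fun a => by
    rw [baseAut_push]
    simp [pushAlg]

/-! ### The group functor `PGO⁺(n)` -/

variable (F S R) in
/-- The group of automorphisms of the `R`-algebra `R ⊗ End_F(S) = End_R(R ⊗ S)`. -/
abbrev AutEnd : Type (max u v) :=
  (R ⊗[F] Module.End F S) ≃ₐ[R] (R ⊗[F] Module.End F S)

/-- `φ = [f]`: the automorphism `φ` of `End_R(R ⊗ S)` is conjugation by the similarity `f`, that
is, `φ(a) f = f a` for all `a`. Here `R ⊗ End_F(S)` acts on `R ⊗ S` through the canonical
isomorphism to `End_R(R ⊗ S)`. -/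
def IsClass (φ : AutEnd F S R) (f : Similitude n R) : Prop :=
  ∀ (a : R ⊗[F] Module.End F S) (x : R ⊗[F] S),
    LinearMap.tensorProductEnd F R S (φ a) (f.toEquiv x) =
      f.toEquiv (LinearMap.tensorProductEnd F R S a x)

theorem tensorProductEnd_tmul (r s : R) (a : Module.End F S) (x : S) :
    LinearMap.tensorProductEnd F R S (r ⊗ₜ a) (s ⊗ₜ x) = (r * s) ⊗ₜ[F] a x := by
  change r • (s ⊗ₜ[F] a x) = _
  rw [TensorProduct.smul_tmul', smul_eq_mul]

theorem tensorProductEnd_push (w : R₁ →ₐ[F] R₂) (a : R₁ ⊗[F] Module.End F S) (x : R₁ ⊗[F] S) :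
    LinearMap.tensorProductEnd F R₂ S (pushAlg _ w a) (push S w x) =
      push S w (LinearMap.tensorProductEnd F R₁ S a x) := by
  induction a with
  | zero => simp
  | add a b ha hb => simp only [map_add, LinearMap.add_apply, ha, hb]
  | tmul r a =>
    induction x with
    | zero => simp
    | add x y hx hy => simp only [map_add, hx, hy]
    | tmul s x =>
      rw [pushAlg, Algebra.TensorProduct.map_tmul, push_tmul, AlgHom.id_apply,
        tensorProductEnd_tmul, tensorProductEnd_tmul, push_tmul, map_mul]

theorem IsClass.base (w : R₁ →ₐ[F] R₂) {φ : AutEnd F S R₁} {f : Similitude n R₁}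
    (h : IsClass φ f) : IsClass (baseAut w φ) (f.base w) := by
  have key : ∀ a : R₁ ⊗[F] Module.End F S,
      LinearMap.tensorProductEnd F R₂ S (baseAut w φ (pushAlg _ w a)) ∘ₗ
          (f.base w).toEquiv.toLinearMap =
        (f.base w).toEquiv.toLinearMap ∘ₗ
          LinearMap.tensorProductEnd F R₂ S (pushAlg _ w a) := by
    intro a
    refine push_ext w fun x => ?_
    simp only [LinearMap.comp_apply, LinearEquiv.coe_coe]
    rw [Similitude.base_push, baseAut_push, tensorProductEnd_push, h a x, tensorProductEnd_push,
      Similitude.base_push]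
  intro a x
  induction a with
  | zero => simp
  | add a b ha hb => simp only [map_add, LinearMap.add_apply, ha, hb]
  | tmul r a =>
    have e : r ⊗ₜ[F] a = r • pushAlg _ w ((1 : R₁) ⊗ₜ[F] a) := by
      simp [pushAlg, TensorProduct.smul_tmul']
    rw [e, map_smul, map_smul, map_smul, LinearMap.smul_apply, LinearMap.smul_apply, map_smul]
    exact congrArg (r • ·) (LinearMap.congr_fun (key (1 ⊗ₜ a)) x)

theorem IsClass.one : IsClass (1 : AutEnd F S R) (Similitude.one : Similitude n R) :=
  fun _ _ => rfl

theorem IsClass.mul {φ ψ : AutEnd F S R} {f g : Similitude n R} (hf : IsClass φ f)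
    (hg : IsClass ψ g) : IsClass (φ * ψ) (f.mul g) := fun a x => by
  have h₁ := hf (ψ a) (g.toEquiv x)
  rw [hg a x] at h₁
  exact h₁

theorem IsClass.inv {φ : AutEnd F S R} {f : Similitude n R} (hf : IsClass φ f) :
    IsClass φ⁻¹ f.inv := fun a x => by
  have h := hf (φ⁻¹ a) (f.toEquiv.symm x)
  have e : φ (φ⁻¹ a) = a := φ.apply_symm_apply a
  rw [e, LinearEquiv.apply_symm_apply] at h
  change _ = f.toEquiv.symm _
  rw [h, LinearEquiv.symm_apply_apply]
  rfl

/-- `R₁ → R₂` is an fppf covering: faithfully flat and of finite presentation. -/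
def IsCover (w : R₁ →ₐ[F] R₂) : Prop :=
  (w : R₁ →+* R₂).FaithfullyFlat ∧ (w : R₁ →+* R₂).FinitePresentation

theorem IsCover.id : IsCover (AlgHom.id F R) :=
  ⟨RingHom.FaithfullyFlat.of_bijective Function.bijective_id, RingHom.FinitePresentation.id R⟩

theorem IsCover.comp {R₃ : Type u} [CommRing R₃] [Algebra F R₃] {w : R₁ →ₐ[F] R₂}
    {w' : R₂ →ₐ[F] R₃} (h' : IsCover w') (h : IsCover w) : IsCover (w'.comp w) :=
  ⟨RingHom.FaithfullyFlat.stableUnderComposition _ _ h.1 h'.1, h'.2.comp h.2⟩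

theorem IsCover.pushout {R₃ : Type u} [CommRing R₃] [Algebra F R₃] {c : R₁ →ₐ[F] R₂}
    (hc : IsCover c) (w : R₁ →ₐ[F] R₃) :
    ∃ (B : Type u) (_ : CommRing B) (_ : Algebra F B) (c' : R₃ →ₐ[F] B) (w' : R₂ →ₐ[F] B),
      IsCover c' ∧ c'.comp w = w'.comp c := by
  let _ : Algebra R₁ R₂ := (c : R₁ →+* R₂).toAlgebra
  let _ : Algebra R₁ R₃ := (w : R₁ →+* R₃).toAlgebra
  have : IsScalarTower F R₁ R₂ := IsScalarTower.of_algebraMap_eq fun x => (c.commutes x).symm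
  have : IsScalarTower F R₁ R₃ := IsScalarTower.of_algebraMap_eq fun x => (w.commutes x).symm
  let i₂ : R₂ →ₐ[F] R₃ ⊗[R₁] R₂ :=
    (Algebra.TensorProduct.includeRight : R₂ →ₐ[R₁] R₃ ⊗[R₁] R₂).restrictScalars F
  let i₁ : R₃ →ₐ[F] R₃ ⊗[R₁] R₂ :=
    (Algebra.TensorProduct.includeLeft : R₃ →ₐ[R₁] R₃ ⊗[R₁] R₂).restrictScalars F
  have hff : Module.FaithfullyFlat R₁ R₂ := hc.1
  have hfp : Algebra.FinitePresentation R₁ R₂ := hc.2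
  refine ⟨R₃ ⊗[R₁] R₂, inferInstance, inferInstance, i₁, i₂, ⟨?_, ?_⟩, ?_⟩
  · have h : Module.FaithfullyFlat R₃ (R₃ ⊗[R₁] R₂) := inferInstance
    exact RingHom.faithfullyFlat_algebraMap_iff.2 h
  · have h : Algebra.FinitePresentation R₃ (R₃ ⊗[R₁] R₂) := inferInstance
    exact RingHom.finitePresentation_algebraMap.2 h
  · ext r
    change (w r) ⊗ₜ[R₁] (1 : R₂) = (1 : R₃) ⊗ₜ[R₁] (c r)
    have h₁ : w r = r • (1 : R₃) := by rw [Algebra.smul_def, mul_one]; rfl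
    have h₂ : c r = r • (1 : R₂) := by rw [Algebra.smul_def, mul_one]; rfl
    rw [h₁, h₂, TensorProduct.smul_tmul]

/-- `φ` is, locally for the fppf topology, of the form `[f]` with `f` a proper similarity. -/
def IsLocallyProper (n : QuadraticForm F S) (φ : AutEnd F S R) : Prop :=
  ∃ (B : Type u) (_ : CommRing B) (_ : Algebra F B) (c : R →ₐ[F] B), IsCover c ∧
    ∃ f : Similitude n B, f.Proper ∧ IsClass (baseAut c φ) f

theorem IsLocallyProper.base (w : R₁ →ₐ[F] R₂) {φ : AutEnd F S R₁} (h : IsLocallyProper n φ) :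
    IsLocallyProper n (baseAut w φ) := by
  obtain ⟨B, _, _, c, hc, f, hf, hφ⟩ := h
  obtain ⟨B', _, _, c', w', hc', e⟩ := hc.pushout w
  refine ⟨B', _, _, c', hc', f.base w', hf.base w', ?_⟩
  rw [← baseAut_comp, e, baseAut_comp]
  exact hφ.base w'

variable (n R) in
/-- The group of `R`-points of `PGO⁺(n) = GO⁺(n) / Gₘ`, the quotient being that of algebraic
groups (fppf sheaves): the automorphisms of the `R`-algebra `End_R(R ⊗ S)` that are locally
conjugation by a proper similarity. -/
def PGOPlusPoints : Subgroup (AutEnd F S R) where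
  carrier := {φ | IsLocallyProper n φ}
  one_mem' := ⟨R, _, _, AlgHom.id F R, IsCover.id, Similitude.one, Similitude.Proper.one, by
    rw [map_one]; exact IsClass.one⟩
  mul_mem' := by
    rintro φ ψ ⟨B, _, _, c, hc, f, hf, hφ⟩ ⟨B', _, _, c', hc', g, hg, hψ⟩
    obtain ⟨B'', _, _, d, d', hd, e⟩ := hc.pushout c'
    refine ⟨B'', _, _, d.comp c', hd.comp hc', (f.base d').mul (g.base d),
      (hf.base d').mul (hg.base d), ?_⟩
    rw [map_mul]
    refine IsClass.mul ?_ ?_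
    · rw [e, baseAut_comp]
      exact hφ.base d'
    · rw [baseAut_comp]
      exact hψ.base d
  inv_mem' := by
    rintro φ ⟨B, _, _, c, hc, f, hf, hφ⟩
    exact ⟨B, _, _, c, hc, f.inv, hf.inv, by rw [map_inv]; exact hφ.inv⟩

variable (n) in
/-- The map `PGO⁺(n)(R₁) → PGO⁺(n)(R₂)` induced by `R₁ → R₂`. -/
def PGOPlusMap (w : R₁ →ₐ[F] R₂) : PGOPlusPoints n R₁ →* PGOPlusPoints n R₂ :=
  ((baseAut w).comp (PGOPlusPoints n R₁).subtype).codRestrict (PGOPlusPoints n R₂)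
    fun φ => φ.2.base w

/-- The algebraic group `PGO⁺(n)`, as a functor from commutative `F`-algebras to groups. -/
def PGOPlus (n : QuadraticForm F S) : CommAlgCat.{u} F ⥤ GrpCat.{max u v} where
  obj R := GrpCat.of (PGOPlusPoints n R)
  map w := GrpCat.ofHom (PGOPlusMap n w.hom)
  map_id R := by
    refine GrpCat.hom_ext (MonoidHom.ext fun φ => ?_)
    exact Subtype.ext (baseAut_id φ.1)
  map_comp w w' := by
    refine GrpCat.hom_ext (MonoidHom.ext fun φ => ?_)
    exact Subtype.ext (baseAut_comp w.hom w'.hom φ.1)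

/-! ### Symmetric compositions -/

/-- The polar form of `n` has radical zero. -/
def Nonsingular (n : QuadraticForm F S) : Prop :=
  ∀ x, (∀ y, QuadraticMap.polar n x y = 0) → x = 0

/-- A symmetric composition on `(S, n)`, with its multiplier (which the multiplication determines
as soon as `n ≠ 0`). -/
structure SymmetricComposition (n : QuadraticForm F S) where
  mul : S →ₗ[F] S →ₗ[F] S
  mult : Fˣ
  form_mul : ∀ x y, n (mul x y) = mult * n x * n y
  polar_mul : ∀ x y z, QuadraticMap.polar n (mul x y) z = QuadraticMap.polar n x (mul y z)

/-- The opposite symmetric composition `x ⋆ᵒᵖ y = y ⋆ x`. -/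
def SymmetricComposition.op (star : SymmetricComposition n) : SymmetricComposition n where
  mul := star.mul.flip
  mult := star.mult
  form_mul := fun x y => by rw [LinearMap.flip_apply, star.form_mul]; ring
  polar_mul := fun x y z => by
    rw [LinearMap.flip_apply, LinearMap.flip_apply, QuadraticMap.polar_comm, ← star.polar_mul,
      QuadraticMap.polar_comm]

theorem SymmetricComposition.mul_mul_left (star : SymmetricComposition n) (hn : Nonsingular n)
    (x y : S) : star.mul x (star.mul y x) = (star.mult * n x) • y := by
  rw [← sub_eq_zero]
  refine hn _ fun z => ?_
  have h : QuadraticMap.polar n (star.mul y x) (star.mul z x)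
      = star.mult * n x * QuadraticMap.polar n y z := by
    simp only [QuadraticMap.polar, ← LinearMap.add_apply, ← map_add, star.form_mul]
    ring
  rw [QuadraticMap.polar_sub_left, QuadraticMap.polar_smul_left, QuadraticMap.polar_comm,
    ← star.polar_mul, QuadraticMap.polar_comm, h, smul_eq_mul, sub_self]

theorem SymmetricComposition.mul_mul_right (star : SymmetricComposition n) (hn : Nonsingular n)
    (x y : S) : star.mul (star.mul x y) x = (star.mult * n x) • y :=
  star.op.mul_mul_left hn x y

variable (R) in
/-- The extension of scalars of the multiplication to `R ⊗ S`. -/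
def SymmetricComposition.mulR (star : SymmetricComposition n) :
    R ⊗[F] S →ₗ[R] R ⊗[F] S →ₗ[R] R ⊗[F] S :=
  LinearMap.BilinMap.baseChange R star.mul

theorem SymmetricComposition.mulR_tmul (star : SymmetricComposition n) (r s : R) (x y : S) :
    star.mulR R (r ⊗ₜ x) (s ⊗ₜ y) = (r * s) ⊗ₜ star.mul x y := rfl

theorem SymmetricComposition.mulR_op (star : SymmetricComposition n) (x y : R ⊗[F] S) :
    star.op.mulR R x y = star.mulR R y x := by
  induction x with
  | zero => simp
  | add x x' hx hx' => simp only [map_add, LinearMap.add_apply, hx, hx']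
  | tmul r x =>
    induction y with
    | zero => simp
    | add y y' hy hy' => simp only [map_add, LinearMap.add_apply, hy, hy']
    | tmul s y => rw [mulR_tmul, mulR_tmul, mul_comm]; rfl

theorem SymmetricComposition.mulR_mulR_left (star : SymmetricComposition n) (hn : Nonsingular n)
    (x y : R ⊗[F] S) : star.mulR R x (star.mulR R y x)
      = (algebraMap F R star.mult * scalar n R x) • y := by
  induction y with
  | zero => simp
  | add y y' hy hy' => simp only [map_add, LinearMap.add_apply, hy, hy', smul_add]
  | tmul s y =>
    have h : LinearMap.BilinMap.toQuadraticMap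
          ((star.mulR R).compl₁₂ LinearMap.id (star.mulR R (s ⊗ₜ y))) =
        (LinearMap.toSpanSingleton R (R ⊗[F] S)
          (algebraMap F R star.mult • (s ⊗ₜ y))).compQuadraticMap (scalar n R) := by
      apply baseChange_ext
      intro m
      simp only [LinearMap.BilinMap.toQuadraticMap_apply, LinearMap.compl₁₂_apply,
        LinearMap.id_apply, LinearMap.compQuadraticMap_apply, LinearMap.toSpanSingleton_apply,
        mulR_tmul, scalar_tmul, star.mul_mul_left hn, one_pow, one_mul, mul_one]
      rw [algebraMap_smul, algebraMap_smul, smul_smul, ← TensorProduct.tmul_smul, mul_comm]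
    have h' := congrArg (fun q : QuadraticMap R (R ⊗[F] S) (R ⊗[F] S) => q x) h
    rw [mul_comm, mul_smul]
    exact h'

theorem SymmetricComposition.mulR_mulR_right (star : SymmetricComposition n)
    (hn : Nonsingular n) (x y : R ⊗[F] S) : star.mulR R (star.mulR R x y) x
      = (algebraMap F R star.mult * scalar n R x) • y := by
  rw [← mulR_op star x (star.mulR R x y), ← mulR_op star y x]
  exact star.op.mulR_mulR_left hn x y

/-! ### The triality map -/

/-- The homomorphism `α₀` from the even Clifford algebra of `(R ⊗ S, n_R)` to
`End_R(R ⊗ S) × End_R(R ⊗ S)`, given by `x y ↦ (λ⁻¹ r_x ℓ_y, λ⁻¹ ℓ_x r_y)`, where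
`ℓ_x(z) = x ⋆ z`, `r_x(z) = z ⋆ x` and `λ` is the multiplier of `⋆`. -/
def alpha0 (hn : Nonsingular n) (star : SymmetricComposition n) (R : Type u) [CommRing R]
    [Algebra F R] :
    C0 n R →ₐ[R] Module.End R (R ⊗[F] S) × Module.End R (R ⊗[F] S) :=
  CliffordAlgebra.even.lift (scalar n R)
    { bilin := LinearMap.mk₂ R
        (fun x y => algebraMap F R (star.mult⁻¹ : Fˣ) •
          (((star.mulR R).flip x ∘ₗ star.mulR R y, star.mulR R x ∘ₗ (star.mulR R).flip y) :
            Module.End R (R ⊗[F] S) × Module.End R (R ⊗[F] S)))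
        (fun x x' y => by
          rw [← smul_add, map_add, map_add, LinearMap.add_comp, LinearMap.add_comp, Prod.mk_add_mk])
        (fun c x y => by
          rw [smul_comm, map_smul, map_smul, LinearMap.smul_comp, LinearMap.smul_comp,
            Prod.smul_mk, Prod.smul_mk, Prod.smul_mk])
        (fun x y y' => by
          rw [← smul_add, map_add, map_add, LinearMap.comp_add, LinearMap.comp_add, Prod.mk_add_mk])
        (fun c x y => by
          rw [smul_comm, map_smul, map_smul, LinearMap.comp_smul, LinearMap.comp_smul,
            Prod.smul_mk, Prod.smul_mk, Prod.smul_mk])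
      contract := fun x => by
        have e : algebraMap F R (star.mult⁻¹ : Fˣ) * algebraMap F R star.mult = 1 := by
          rw [← map_mul, Units.inv_mul, map_one]
        refine Prod.ext (LinearMap.ext fun z => ?_) (LinearMap.ext fun z => ?_)
        · change algebraMap F R (star.mult⁻¹ : Fˣ) • star.mulR R (star.mulR R x z) x
            = scalar n R x • z
          rw [star.mulR_mulR_right hn, smul_smul, ← mul_assoc, e, one_mul]
        · change algebraMap F R (star.mult⁻¹ : Fˣ) • star.mulR R x (star.mulR R z x)
            = scalar n R x • z
          rw [star.mulR_mulR_left hn, smul_smul, ← mul_assoc, e, one_mul]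
      contract_mid := fun x y w => by
        have e : algebraMap F R (star.mult⁻¹ : Fˣ) * algebraMap F R star.mult = 1 := by
          rw [← map_mul, Units.inv_mul, map_one]
        refine Prod.ext (LinearMap.ext fun z => ?_) (LinearMap.ext fun z => ?_)
        · change algebraMap F R (star.mult⁻¹ : Fˣ) • star.mulR R (star.mulR R y
              (algebraMap F R (star.mult⁻¹ : Fˣ) • star.mulR R (star.mulR R w z) y)) x
            = scalar n R y • algebraMap F R (star.mult⁻¹ : Fˣ) • star.mulR R (star.mulR R w z) x
          rw [map_smul, star.mulR_mulR_left hn, smul_smul (algebraMap F R (star.mult⁻¹ : Fˣ)),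
            ← mul_assoc, e, one_mul, map_smul, LinearMap.smul_apply, smul_comm]
        · change algebraMap F R (star.mult⁻¹ : Fˣ) • star.mulR R x (star.mulR R
              (algebraMap F R (star.mult⁻¹ : Fˣ) • star.mulR R y (star.mulR R z w)) y)
            = scalar n R y • algebraMap F R (star.mult⁻¹ : Fˣ) • star.mulR R x (star.mulR R z w)
          rw [map_smul, LinearMap.smul_apply, star.mulR_mulR_right hn,
            smul_smul (algebraMap F R (star.mult⁻¹ : Fˣ)), ← mul_assoc, e, one_mul, map_smul,
            smul_comm] }

/-- The diagram `D⁺(f, g, h)` commutes: `α₀ ∘ C₀[f] = (Int[g] × Int[h]) ∘ α₀`. -/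
def Diagram (hn : Nonsingular n) (star : SymmetricComposition n) (f g h : Similitude n R) :
    Prop :=
  ∀ c : C0 n R, alpha0 hn star R (f.mapC0 c) =
    (g.toEquiv.conj (alpha0 hn star R c).1, h.toEquiv.conj (alpha0 hn star R c).2)

/-- The relation between `R`-points of `PGO⁺(n)` that defines the triality map: locally for the
fppf topology, `φ = [f]` and `ψ = [g]` for proper similarities `f`, `g`, `h` such that
`D⁺(f, g, h)` commutes. -/
def TrialityRel (hn : Nonsingular n) (star : SymmetricComposition n)
    (φ ψ : PGOPlusPoints n R) : Prop :=
  ∃ (B : Type u) (_ : CommRing B) (_ : Algebra F B) (c : R →ₐ[F] B), IsCover c ∧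
    ∃ f g h : Similitude n B, f.Proper ∧ g.Proper ∧ h.Proper ∧
      IsClass (baseAut c φ.1) f ∧ IsClass (baseAut c ψ.1) g ∧ Diagram hn star f g h

open Classical in
/-- The map `ρ_⋆` on `R`-points: it sends `φ` to an element `ψ` in the triality relation with
`φ` (and to `1` if there is none). -/
def rho (hn : Nonsingular n) (star : SymmetricComposition n) (φ : PGOPlusPoints n R) :
    PGOPlusPoints n R :=
  if h : ∃ ψ, TrialityRel hn star φ ψ then h.choose else 1

variable (R) in
/-- The action on `R`-points of an automorphism of the algebraic group `PGO⁺(n)`. -/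
def onPoints (τ : Aut (PGOPlus n)) : PGOPlusPoints n R →* PGOPlusPoints n R :=
  (τ.hom.app (CommAlgCat.of F R)).hom

/-- The automorphism `τ` of the algebraic group `PGO⁺(n)` is outer: neither over `F` nor over a
field extension `K` of `F` is it conjugation by a `K`-point. -/
def IsOuter (τ : Aut (PGOPlus n)) : Prop :=
  ∀ (K : Type u) [Field K] [Algebra F K] (p : PGOPlusPoints n K),
    ¬ ∀ (R : Type u) [CommRing R] [Algebra F R] (w : K →ₐ[F] R) (φ : PGOPlusPoints n R),
      onPoints R τ φ = PGOPlusMap n w p * φ * (PGOPlusMap n w p)⁻¹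

end Forms

end

end Triality

open Triality

namespace Triality

noncomputable section

variable {F : Type u} [Field F] {S : Type v} [AddCommGroup S] [Module F S] {n : QuadraticForm F S}
variable {R : Type u} [CommRing R] [Algebra F R]
variable {R₁ : Type u} [CommRing R₁] [Algebra F R₁] {R₂ : Type u} [CommRing R₂] [Algebra F R₂]

/-! ### The polar form and the multiplication over a commutative algebra -/

/-! Call (f, g, h) a triple if c f(x ⋆ y) = g(x) ⋆ h(y) for some unit c. The identity b(x ⋆ y, z) =
b(x, y ⋆ z) makes this notion cyclic: (g, h, f) is then a triple as well (`Triple.rotate`), while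
passing to ⋆ᵒᵖ exchanges g and h. Suppose that [f] determines [g] and that every point is locally
the class of the first member of a triple. Then ρ is [f] ↦ [g]. Products of triples make it
multiplicative, three rotations give ρ³ = 1, and (g, f, h), a triple for ⋆ᵒᵖ, gives the inverse.

Both suppositions rest on α₀ being an isomorphism. The operators (u, v) ↦ (λ⁻¹ v ⋆ x, x ⋆ u) on S ×
S square to n(x), so they represent the Clifford algebra; since dim End(S × S) = 2⁸, counting
ordered products shows that this representation is bijective (`SymmetricComposition.bijective_rep`).
Its even part, extended to R, is α₀ (`bijective_alpha0`). For proper f, C₀(f) fixes the central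
idempotent over (1, 0), hence induces an endomorphism of the first factor End(R ⊗ S), which becomes
conjugation by some linear g after a covering (`exists_cover_conj`). The norm identities of ⋆ then
force g to be a similarity and supply h (`Intertwines.exists_triple`). Conversely α₀ is onto, so [f]
determines [g] (`Intertwines.isClass`); hence the two pullbacks of [g] to B ⊗ B agree, and [g]
descends along the covering.

Outerness compares eigenvectors. For independent anisotropic x, y, a product of reflections in x and
y scales any anisotropic z orthogonal to both. Its image under ρ is the class of z ↦ (y ⋆ z) ⋆ x,
which has no eigenvector of invertible norm. Conjugation by a point would preserve the existence of
one. -/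

theorem polar_scalar_tmul (n : QuadraticForm F S) (r s : R) (x y : S) :
    QuadraticMap.polar (scalar n R) (r ⊗ₜ x) (s ⊗ₜ y) =
      r * s * algebraMap F R (QuadraticMap.polar n x y) := by
  have h : QuadraticMap.polar n x y = lower n x y + lower n y x := by
    simp only [QuadraticMap.polar, ← lower_self, map_add, LinearMap.add_apply]
    ring
  rw [scalar, LinearMap.BilinMap.polar_toQuadraticMap, LinearMap.BilinForm.baseChange_tmul,
    LinearMap.BilinForm.baseChange_tmul, h, Algebra.smul_def, Algebra.smul_def, map_add]
  ring

/-- A quadratic form on R ⊗ S is determined by its values on 1 ⊗ S. With one argument fixed, both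
sides are quadratic in the other, so the identity is extended from S one variable at a time. -/
theorem SymmetricComposition.scalar_mulR (star : SymmetricComposition n) (x y : R ⊗[F] S) :
    scalar n R (star.mulR R x y) = algebraMap F R star.mult * scalar n R x * scalar n R y := by
  have h₁ : ∀ m : S, (scalar n R).comp (star.mulR R (1 ⊗ₜ m)) =
      (algebraMap F R star.mult * scalar n R (1 ⊗ₜ m)) • scalar n R := by
    intro m
    apply baseChange_ext
    intro m'
    simp [SymmetricComposition.mulR_tmul, scalar_tmul, star.form_mul]
  have h₂ : (scalar n R).comp ((star.mulR R).flip y) =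
      (algebraMap F R star.mult * scalar n R y) • scalar n R := by
    apply baseChange_ext
    intro m
    have := congrArg (fun q : QuadraticForm R (R ⊗[F] S) => q y) (h₁ m)
    simp only [QuadraticMap.comp_apply, smul_apply, smul_eq_mul,
      LinearMap.flip_apply] at this ⊢
    rw [this]; ring
  have := congrArg (fun q : QuadraticForm R (R ⊗[F] S) => q x) h₂
  simp only [QuadraticMap.comp_apply, smul_apply, smul_eq_mul,
    LinearMap.flip_apply] at this
  rw [this]; ring

theorem SymmetricComposition.polar_mulR (star : SymmetricComposition n) (x y z : R ⊗[F] S) :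
    QuadraticMap.polar (scalar n R) (star.mulR R x y) z =
      QuadraticMap.polar (scalar n R) x (star.mulR R y z) := by
  induction x with
  | zero => simp
  | add x x' hx hx' =>
    simp only [map_add, LinearMap.add_apply, QuadraticMap.polar_add_left, hx, hx']
  | tmul r x =>
    induction y with
    | zero => simp
    | add y y' hy hy' =>
      simp only [map_add, LinearMap.add_apply, QuadraticMap.polar_add_left,
        QuadraticMap.polar_add_right, hy, hy']
    | tmul s y =>
      induction z with
      | zero => simp
      | add z z' hz hz' => simp only [map_add, QuadraticMap.polar_add_right, hz, hz']
      | tmul t z =>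
        rw [mulR_tmul, mulR_tmul, polar_scalar_tmul, polar_scalar_tmul, star.polar_mul]
        ring

theorem SymmetricComposition.mulR_push (star : SymmetricComposition n) (w : R₁ →ₐ[F] R₂)
    (x y : R₁ ⊗[F] S) :
    star.mulR R₂ (push S w x) (push S w y) = push S w (star.mulR R₁ x y) := by
  induction x with
  | zero => simp
  | add x x' hx hx' => simp only [map_add, LinearMap.add_apply, hx, hx']
  | tmul r x =>
    induction y with
    | zero => simp
    | add y y' hy hy' => simp only [map_add, hy, hy']
    | tmul s y => simp [mulR_tmul]

/-! ### Nondegeneracy and dual bases after extension of scalars -/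

theorem Nonsingular.nondegenerate (hn : Nonsingular n) :
    LinearMap.BilinForm.Nondegenerate (QuadraticMap.polarBilin n) := by
  refine ⟨fun x hx => hn x fun y => hx y, fun x hx => hn x fun y => ?_⟩
  rw [QuadraticMap.polar_comm]
  exact hx y

/-- A basis of `S` has a dual basis for the polar form. -/
theorem Nonsingular.exists_dual {ι : Type*} [Finite ι] [DecidableEq ι] (hn : Nonsingular n)
    (s : Module.Basis ι F S) :
    ∃ t : ι → S, ∀ i j, QuadraticMap.polar n (t i) (s j) = if j = i then 1 else 0 :=
  ⟨LinearMap.BilinForm.dualBasis _ hn.nondegenerate s, fun i j =>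
    LinearMap.BilinForm.apply_dualBasis_left (hB := hn.nondegenerate) (b := s) i j⟩

/-- Dual bases over F give x = ∑ b(x, 1 ⊗ tⱼ) (1 ⊗ sⱼ) on all of R ⊗ S, so nondegeneracy survives
every extension of scalars. -/
theorem Nonsingular.eq_zero_of_polar [FiniteDimensional F S] (hn : Nonsingular n)
    {x : R ⊗[F] S} (h : ∀ y, QuadraticMap.polar (scalar n R) x y = 0) : x = 0 := by
  classical
  let s := Module.finBasis F S
  obtain ⟨t, ht⟩ := hn.exists_dual s
  have hs : ∀ x : R ⊗[F] S, x =
      ∑ j, QuadraticMap.polar (scalar n R) x (1 ⊗ₜ t j) • ((1 : R) ⊗ₜ[F] s j) := by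
    intro x
    induction x with
    | zero => simp
    | add x y hx hy =>
      conv_lhs => rw [hx, hy]
      simp only [QuadraticMap.polar_add_left, add_smul, Finset.sum_add_distrib]
    | tmul r x =>
      have hx : x = ∑ j, QuadraticMap.polar n (t j) x • s j := by
        conv_lhs => rw [← s.sum_repr x]
        refine Finset.sum_congr rfl fun j _ => ?_
        congr 1
        conv_rhs => rw [← s.sum_repr x]
        rw [← QuadraticMap.polarBilin_apply_apply, map_sum]
        simp [ht]
      conv_lhs => rw [hx, TensorProduct.tmul_sum]
      refine Finset.sum_congr rfl fun j _ => ?_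
      rw [polar_scalar_tmul, TensorProduct.tmul_smul, TensorProduct.smul_tmul',
        TensorProduct.smul_tmul', QuadraticMap.polar_comm, Algebra.smul_def]
      congr 1
      simp [mul_comm]
  rw [hs x]
  simp [h]

theorem Nonsingular.exists_ne_zero [Nontrivial S] (hn : Nonsingular n) : ∃ e, n e ≠ 0 := by
  by_contra! h
  obtain ⟨x, hx⟩ := exists_ne (0 : S)
  exact hx (hn x fun y => by simp [QuadraticMap.polar, h])

theorem isUnit_scalar_one_tmul {e : S} (he : n e ≠ 0) :
    IsUnit (scalar n R (1 ⊗ₜ e)) := by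
  rw [scalar_tmul, one_pow, one_mul]
  exact (IsUnit.mk0 _ he).map (algebraMap F R)

theorem SymmetricComposition.isUnit_mult (star : SymmetricComposition n) :
    IsUnit (algebraMap F R star.mult) := star.mult.isUnit.map (algebraMap F R)

/-- The `R`-linear form on `R ⊗ S` induced by a linear form on `S`. -/
def formR (R : Type u) [CommRing R] [Algebra F R] (l : S →ₗ[F] F) : R ⊗[F] S →ₗ[R] R :=
  (TensorProduct.AlgebraTensorModule.rid F R R).toLinearMap ∘ₗ l.baseChange R

@[simp] theorem formR_tmul (l : S →ₗ[F] F) (r : R) (x : S) :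
    formR R l (r ⊗ₜ x) = l x • r := by
  simp [formR]

theorem exists_form_eq_one {e : S} (he : e ≠ 0) : ∃ l : S →ₗ[F] F, l e = 1 := by
  obtain ⟨l, hl⟩ := not_forall.1 (mt (Module.forall_dual_apply_eq_zero_iff F e).1 he)
  exact ⟨(l e)⁻¹ • l, by simp [inv_mul_cancel₀ hl]⟩

/-- Scalars act faithfully on `R ⊗ S`. -/
theorem eq_of_smul_one_tmul {e : S} (he : e ≠ 0) {r s : R}
    (h : r • ((1 : R) ⊗ₜ[F] e) = s • (1 ⊗ₜ e)) : r = s := by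
  obtain ⟨l, hl⟩ := exists_form_eq_one (F := F) he
  simpa [hl] using congrArg (formR R l) h

/-- An endomorphism of `R ⊗ S` that commutes with all endomorphisms of `S` is a scalar. -/
theorem exists_eq_smul (T : Module.End R (R ⊗[F] S))
    (h : ∀ (a : Module.End F S) x, T (LinearMap.tensorProductEnd F R S (1 ⊗ₜ a) x) =
      LinearMap.tensorProductEnd F R S (1 ⊗ₜ a) (T x)) : ∃ r : R, ∀ x, T x = r • x := by
  rcases subsingleton_or_nontrivial S with hS | hS
  · exact ⟨0, fun x => Subsingleton.elim _ _⟩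
  obtain ⟨e, he⟩ := exists_ne (0 : S)
  obtain ⟨l, hl⟩ := exists_form_eq_one (F := F) he
  -- Commuting with the rank-one operators l(·) m is enough: evaluated at e, where l(e) = 1, it
  -- gives T(1 ⊗ m) = l(T(1 ⊗ e)) (1 ⊗ m).
  have key : ∀ (m : S) x, LinearMap.tensorProductEnd F R S (1 ⊗ₜ l.smulRight m) x =
      formR R l x • (1 ⊗ₜ m) := by
    intro m x
    induction x with
    | zero => simp
    | add x y hx hy => simp only [map_add, add_smul, hx, hy]
    | tmul r x =>
      rw [tensorProductEnd_tmul, formR_tmul, TensorProduct.smul_tmul', one_mul,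
        LinearMap.smulRight_apply, TensorProduct.tmul_smul, TensorProduct.smul_tmul', smul_eq_mul,
        mul_one]
  refine ⟨formR R l (T (1 ⊗ₜ e)), fun x => ?_⟩
  have : T = formR R l (T (1 ⊗ₜ e)) • LinearMap.id := by
    apply TensorProduct.AlgebraTensorModule.ext
    intro r m
    have e₁ : r ⊗ₜ[F] m = r • ((1 : R) ⊗ₜ[F] m) := by simp [TensorProduct.smul_tmul']
    have h₁ := h (l.smulRight m) (1 ⊗ₜ e)
    rw [key, key, formR_tmul, hl, one_smul, one_smul] at h₁
    rw [e₁, map_smul, h₁, smul_comm]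
    rfl
  conv_lhs => rw [this]
  rfl

end

end Triality

namespace Triality

noncomputable section

/-! ### Ordered products of anticommuting elements -/

section OrderedProducts

variable {F : Type*} [Field F] {A : Type*} [Ring A] [Algebra F A]

/-- The span of the products `y i₁ ⋯ y iₘ` with `i₁ < ⋯ < iₘ < k`. -/
def orderedSpan (F : Type*) [Field F] {A : Type*} [Ring A] [Algebra F A] (y : ℕ → A) :
    ℕ → Submodule F A
  | 0 => Submodule.span F {1}
  | k + 1 => orderedSpan F y k ⊔ (orderedSpan F y k).map (LinearMap.mulRight F (y k))

variable {y : ℕ → A}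

theorem finite_orderedSpan (k : ℕ) : Module.Finite F (orderedSpan F y k) := by
  induction k with
  | zero => rw [orderedSpan]; infer_instance
  | succ k ih => rw [orderedSpan]; infer_instance

theorem finrank_orderedSpan_le (k : ℕ) : Module.finrank F (orderedSpan F y k) ≤ 2 ^ k := by
  induction k with
  | zero => exact (finrank_span_le_card ({1} : Set A)).trans (by simp)
  | succ k ih =>
    have := finite_orderedSpan (F := F) (y := y) k
    rw [orderedSpan]
    have h₁ := Submodule.finrank_add_le_finrank_add_finrank (orderedSpan F y k)
      ((orderedSpan F y k).map (LinearMap.mulRight F (y k)))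
    have h₂ := Submodule.finrank_map_le (LinearMap.mulRight F (y k)) (orderedSpan F y k)
    rw [pow_succ]
    omega

theorem one_mem_orderedSpan (k : ℕ) : (1 : A) ∈ orderedSpan F y k := by
  induction k with
  | zero => exact Submodule.mem_span_singleton_self 1
  | succ k ih => exact Submodule.mem_sup_left ih

theorem orderedSpan_induction {P : A → Prop} {k : ℕ} (one : P 1)
    (add : ∀ a b, P a → P b → P (a + b)) (smul : ∀ (c : F) a, P a → P (c • a))
    (mul : ∀ i < k, ∀ a, P a → P (a * y i)) {a : A} (ha : a ∈ orderedSpan F y k) : P a := by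
  induction k generalizing a with
  | zero =>
    obtain ⟨c, rfl⟩ := Submodule.mem_span_singleton.1 ha
    exact smul c 1 one
  | succ k ih =>
    have ih' := fun {a} => @ih (fun i hi => mul i (hi.trans k.lt_succ_self)) a
    obtain ⟨b, hb, c, hc, rfl⟩ := Submodule.mem_sup.1 ha
    obtain ⟨d, hd, rfl⟩ := hc
    exact add _ _ (ih' hb) (mul k k.lt_succ_self d (ih' hd))

/-- An earlier generator is moved past yₖ at the cost of a scalar: d yₖ yᵢ = c d − d yᵢ yₖ. So the
span of ordered products is stable under right multiplication. -/
theorem mul_mem_orderedSpan {k : ℕ}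
    (hsq : ∀ i < k, ∃ c : F, y i * y i = algebraMap F A c)
    (hanti : ∀ i < k, ∀ j < k, ∃ c : F, y i * y j + y j * y i = algebraMap F A c)
    {i : ℕ} (hi : i < k) {a : A} (ha : a ∈ orderedSpan F y k) :
    a * y i ∈ orderedSpan F y k := by
  induction k generalizing a i with
  | zero => omega
  | succ k ih =>
    have ih' := fun {i} hi {a} ha => @ih (fun i hi => hsq i (hi.trans k.lt_succ_self))
      (fun i hi j hj => hanti i (hi.trans k.lt_succ_self) j (hj.trans k.lt_succ_self)) i hi a ha
    obtain ⟨b, hb, c, ⟨d, hd, rfl⟩, rfl⟩ := Submodule.mem_sup.1 ha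
    rw [LinearMap.mulRight_apply, add_mul, mul_assoc]
    have hbk : ∀ b ∈ orderedSpan F y k, b * y k ∈ orderedSpan F y (k + 1) := fun b hb =>
      Submodule.mem_sup_right ⟨b, hb, rfl⟩
    have hle : orderedSpan F y k ≤ orderedSpan F y (k + 1) := le_sup_left
    rcases Nat.lt_succ_iff_lt_or_eq.1 hi with hik | rfl
    · obtain ⟨c, hc⟩ := hanti k k.lt_succ_self i hi
      have e : d * (y k * y i) = c • d - d * y i * y k := by
        rw [eq_sub_of_add_eq hc, mul_sub, ← Algebra.commutes, ← Algebra.smul_def, mul_assoc]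
      rw [e]
      exact add_mem (hle (ih' hik hb)) (sub_mem (hle (Submodule.smul_mem _ c hd))
        (hbk _ (ih' hik hd)))
    · obtain ⟨c, hc⟩ := hsq i hi
      rw [hc, ← Algebra.commutes, ← Algebra.smul_def]
      exact add_mem (hbk b hb) (hle (Submodule.smul_mem _ c hd))

/-- The tᵢ act as contractions, so no orthogonal basis is needed and characteristic 2 is covered. On
the span of the earlier products tₖ a = J(a) tₖ. If b and b yₖ both lie there, computing tₖ b yₖ in
two ways gives J(b)(tₖ yₖ + yₖ tₖ) = 0, so b = 0. Hence right multiplication by yₖ is injective on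
that span and its image meets it trivially: the dimension doubles. -/
theorem finrank_orderedSpan [Nontrivial A] (J : A →ₐ[F] A) (hJ : Function.Injective J) (t : ℕ → A)
    (N : ℕ) (hy : ∀ i < N, J (y i) = -y i)
    (hty : ∀ i < N, ∀ j < N, t i * y j + y j * t i = if i = j then 1 else 0) {k : ℕ} (hk : k ≤ N) :
    Module.finrank F (orderedSpan F y k) = 2 ^ k := by
  induction k with
  | zero => exact finrank_span_singleton one_ne_zero
  | succ k ih =>
    have hkN : k < N := hk
    have hcomm : ∀ a ∈ orderedSpan F y k, t k * a = J a * t k := by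
      intro a ha
      refine orderedSpan_induction (P := fun a => t k * a = J a * t k) ?_ ?_ ?_ ?_ ha
      · simp
      · intro a b ha hb; rw [mul_add, ha, hb, map_add, add_mul]
      · intro c a ha; rw [mul_smul_comm, ha, map_smul, smul_mul_assoc]
      · intro i hi a ha
        have h := hty k hkN i (hi.trans hkN)
        rw [if_neg hi.ne'] at h
        rw [← mul_assoc, ha, mul_assoc, eq_neg_of_add_eq_zero_left h, map_mul,
          hy i (hi.trans hkN), mul_assoc, neg_mul]
    have hdisj : ∀ b ∈ orderedSpan F y k, b * y k ∈ orderedSpan F y k → b = 0 := by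
      intro b hb hbk
      have h := hty k hkN k hkN
      rw [if_pos rfl] at h
      have h₁ := hcomm _ hbk
      rw [← mul_assoc, hcomm b hb, map_mul, hy k hkN, mul_assoc, mul_assoc, ← sub_eq_zero,
        ← mul_sub, neg_mul, sub_neg_eq_add, h, mul_one] at h₁
      exact hJ (h₁.trans (map_zero J).symm)
    have := finite_orderedSpan (F := F) (y := y) k
    have hinf : orderedSpan F y k ⊓ (orderedSpan F y k).map (LinearMap.mulRight F (y k)) = ⊥ := by
      rw [eq_bot_iff]
      rintro _ ⟨ha, ⟨b, hb, rfl⟩⟩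
      rw [Submodule.mem_bot, hdisj b hb ha, map_zero]
    have hmap : Module.finrank F ((orderedSpan F y k).map (LinearMap.mulRight F (y k))) =
        Module.finrank F (orderedSpan F y k) := by
      rw [← LinearMap.range_domRestrict]
      refine LinearMap.finrank_range_of_inj ((injective_iff_map_eq_zero _).2 fun b hb => ?_)
      have hb' : (b : A) * y k = 0 := hb
      exact Subtype.ext (hdisj b b.2 (hb' ▸ zero_mem _))
    have h := Submodule.finrank_sup_add_finrank_inf_eq (orderedSpan F y k)
      ((orderedSpan F y k).map (LinearMap.mulRight F (y k)))
    rw [hinf, finrank_bot, add_zero, hmap, ih hkN.le] at h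
    rw [orderedSpan, h, pow_succ, mul_two]

end OrderedProducts

/-! ### The representation of the Clifford algebra attached to a symmetric composition -/

variable {F : Type u} [Field F] {S : Type v} [AddCommGroup S] [Module F S] {n : QuadraticForm F S}
variable {R : Type u} [CommRing R] [Algebra F R]

theorem bijective_tensorProductEnd [FiniteDimensional F S] :
    Function.Bijective (LinearMap.tensorProductEnd F R S) := by
  have h : (LinearMap.tensorProductEnd F R S).toLinearMap =
      (TensorProduct.isBaseChange F S R).end.equiv.toLinearMap := by
    apply TensorProduct.AlgebraTensorModule.ext
    intro r a
    apply TensorProduct.AlgebraTensorModule.ext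
    intro s x
    change LinearMap.tensorProductEnd F R S (r ⊗ₜ a) (s ⊗ₜ x) =
      ((TensorProduct.isBaseChange F S R).end.equiv (r ⊗ₜ a)) (s ⊗ₜ x)
    have e : s ⊗ₜ[F] x = s • TensorProduct.mk F R S 1 x := by simp [TensorProduct.smul_tmul']
    rw [tensorProductEnd_tmul, IsBaseChange.equiv_tmul, e, map_smul, LinearMap.smul_apply,
      IsBaseChange.endHom_comp_apply, TensorProduct.mk_apply, TensorProduct.smul_tmul',
      TensorProduct.smul_tmul', smul_eq_mul, smul_eq_mul, mul_one, mul_comm]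
  have h' : ⇑(LinearMap.tensorProductEnd F R S) =
      (TensorProduct.isBaseChange F S R).end.equiv := funext fun x => LinearMap.congr_fun h x
  rw [h']
  exact LinearEquiv.bijective _

/-- The operator `(u, v) ↦ (λ⁻¹ v ⋆ x, x ⋆ u)` on `S × S`. -/
def SymmetricComposition.vec (star : SymmetricComposition n) : S →ₗ[F] Module.End F (S × S) where
  toFun x := ((star.mult⁻¹ : Fˣ) : F) • LinearMap.inl F S S ∘ₗ star.mul.flip x ∘ₗ LinearMap.snd F S S
    + LinearMap.inr F S S ∘ₗ star.mul x ∘ₗ LinearMap.fst F S S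
  map_add' x y := by ext <;> simp
  map_smul' c x := by ext <;> simp [smul_comm c]

@[simp] theorem SymmetricComposition.vec_apply (star : SymmetricComposition n) (x u v : S) :
    star.vec x (u, v) = (((star.mult⁻¹ : Fˣ) : F) • star.mul v x, star.mul x u) := by
  simp [vec]

/-- This is the pair of identities (x ⋆ u) ⋆ x = λ n(x) u and x ⋆ (v ⋆ x) = λ n(x) v, one for each
copy of S. -/
theorem SymmetricComposition.vec_mul_self (hn : Nonsingular n) (star : SymmetricComposition n)
    (x : S) : star.vec x * star.vec x = algebraMap F _ (n x) := by
  refine LinearMap.ext fun ⟨u, v⟩ => ?_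
  simp only [Module.End.mul_apply, vec_apply, Module.algebraMap_end_apply, map_smul,
    star.mul_mul_left hn, star.mul_mul_right hn, smul_smul, Units.inv_mul_cancel_left]
  rfl

/-- The representation of the Clifford algebra of `n` on `S × S`. -/
def SymmetricComposition.rep (hn : Nonsingular n) (star : SymmetricComposition n) :
    CliffordAlgebra n →ₐ[F] Module.End F (S × S) :=
  CliffordAlgebra.lift n ⟨star.vec, star.vec_mul_self hn⟩

@[simp] theorem SymmetricComposition.rep_ι (hn : Nonsingular n) (star : SymmetricComposition n)
    (x : S) : star.rep hn (CliffordAlgebra.ι n x) = star.vec x := by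
  simp [rep]

/-- The span contains 1 and is stable under right multiplication by the basis vectors, hence by all
of S. This bounds the dimension of the Clifford algebra from above. -/
theorem clifford_orderedSpan_eq_top (n : QuadraticForm F S) {k : ℕ}
    (s : Module.Basis (Fin k) F S) (y : ℕ → CliffordAlgebra n)
    (hy : ∀ i : Fin k, y i = CliffordAlgebra.ι n (s i)) : orderedSpan F y k = ⊤ := by
  have hsq : ∀ i < k, ∃ c : F, y i * y i = algebraMap F _ c := fun i hi => by
    rw [hy ⟨i, hi⟩, CliffordAlgebra.ι_sq_scalar]; exact ⟨_, rfl⟩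
  have hanti : ∀ i < k, ∀ j < k, ∃ c : F, y i * y j + y j * y i = algebraMap F _ c :=
    fun i hi j hj => by
      rw [hy ⟨i, hi⟩, hy ⟨j, hj⟩, CliffordAlgebra.ι_mul_ι_add_swap]; exact ⟨_, rfl⟩
  refine eq_top_iff.2 fun z _ => ?_
  induction z using CliffordAlgebra.right_induction with
  | algebraMap r =>
    rw [Algebra.algebraMap_eq_smul_one]
    exact Submodule.smul_mem _ _ (one_mem_orderedSpan k)
  | add a b ha hb => exact add_mem (ha trivial) (hb trivial)
  | mul_ι m a ha =>
    rw [← s.sum_repr m, map_sum, Finset.mul_sum]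
    refine Submodule.sum_mem _ fun i _ => ?_
    rw [map_smul, mul_smul_comm, ← hy]
    exact Submodule.smul_mem _ _ (mul_mem_orderedSpan hsq hanti i.2 (ha trivial))

/-- Dimension count: ordered products bound the Clifford algebra by 2⁸, and the corresponding
products of the operators `vec` are independent, so they already fill End(S × S), of dimension 16² =
2⁸. -/
theorem SymmetricComposition.bijective_rep (hdim : Module.finrank F S = 8) (hn : Nonsingular n)
    (star : SymmetricComposition n) : Function.Bijective (star.rep hn) := by
  classical
  have hfin : FiniteDimensional F S := Module.finite_of_finrank_pos (by omega)
  have hnt : Nontrivial S := Module.nontrivial_of_finrank_pos (R := F) (by omega)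
  let s := Module.finBasisOfFinrankEq F S hdim
  obtain ⟨t, ht⟩ := hn.exists_dual s
  -- Families over ℕ to match `orderedSpan`; the value 0 from index 8 on is never used.
  let ext (f : Fin 8 → S) (i : ℕ) : S := if h : i < 8 then f ⟨i, h⟩ else 0
  have hext : ∀ f (i : Fin 8), ext f i = f i := fun f i => dif_pos i.2
  let y : ℕ → CliffordAlgebra n := fun i => CliffordAlgebra.ι n (ext s i)
  have htop : orderedSpan F y 8 = ⊤ := clifford_orderedSpan_eq_top n s y fun i => by
    simp only [y, hext]
  have hfinC : Module.Finite F (CliffordAlgebra n) := by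
    have := finite_orderedSpan (F := F) (y := y) 8
    rw [htop] at this
    exact Module.Finite.equiv Submodule.topEquiv
  have hle : Module.finrank F (CliffordAlgebra n) ≤ 2 ^ 8 := by
    have := finrank_orderedSpan_le (F := F) (y := y) 8
    rwa [htop, finrank_top] at this
  -- Conjugation by (u, v) ↦ (u, −v) is the grading automorphism: it negates `vec x` because `vec x`
  -- exchanges the two copies of S.
  let e : (S × S) ≃ₗ[F] (S × S) := (LinearEquiv.refl F S).prodCongr (LinearEquiv.neg F)
  let J := LinearEquiv.conjAlgEquiv F e
  have hJ : ∀ x, J (star.vec x) = -star.vec x := by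
    intro x
    refine LinearMap.ext fun ⟨u, v⟩ => ?_
    have he : ∀ u v, e (u, v) = (u, -v) := fun _ _ => rfl
    have he' : ∀ u v, e.symm (u, v) = (u, -v) := fun _ _ => rfl
    simp [J, LinearEquiv.conjAlgEquiv_apply, he, he']
  have hpol : ∀ x z, star.vec x * star.vec z + star.vec z * star.vec x =
      algebraMap F _ (QuadraticMap.polar n x z) := by
    intro x z
    rw [← star.rep_ι hn, ← star.rep_ι hn, ← map_mul (star.rep hn), ← map_mul (star.rep hn),
      ← map_add (star.rep hn),
      CliffordAlgebra.ι_mul_ι_add_swap, AlgHom.commutes]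
  have hrank := finrank_orderedSpan (F := F) (y := fun i => star.vec (ext s i))
    (J : _ →ₐ[F] _) J.injective
    (fun i => star.vec (ext t i)) 8 (fun i _ => hJ _) (fun i hi j hj => by
      have h₁ := hext t ⟨i, hi⟩
      have h₂ := hext s ⟨j, hj⟩
      simp only at h₁ h₂
      rw [hpol, h₁, h₂, ht]
      simp only [Fin.mk.injEq, eq_comm (a := j)]
      split <;> simp) le_rfl
  have hrange : orderedSpan F (fun i => star.vec (ext s i)) 8 ≤
      LinearMap.range (star.rep hn).toLinearMap := by
    intro a ha
    refine orderedSpan_induction (P := fun a => a ∈ LinearMap.range (star.rep hn).toLinearMap)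
      ⟨1, map_one (star.rep hn)⟩ (fun a b ha hb => add_mem ha hb) (fun c a ha => Submodule.smul_mem _ c ha)
      ?_ ha
    rintro i - _ ⟨z, rfl⟩
    exact ⟨z * CliffordAlgebra.ι n (ext s i), by simp⟩
  have hEnd : Module.finrank F (Module.End F (S × S)) = 2 ^ 8 := by
    refine (Module.finrank_linearMap F F (S × S) (S × S)).trans ?_
    rw [Module.finrank_prod, hdim]; norm_num
  have htop' : LinearMap.range (star.rep hn).toLinearMap = ⊤ := by
    refine top_le_iff.1 (le_trans (le_of_eq ?_) hrange)
    exact (Submodule.eq_top_of_finrank_eq (hrank.trans hEnd.symm)).symm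
  have hsurj : Function.Surjective (star.rep hn).toLinearMap := LinearMap.range_eq_top.1 htop'
  have heq : Module.finrank F (CliffordAlgebra n) = Module.finrank F (Module.End F (S × S)) :=
    le_antisymm (hle.trans hEnd.ge) (LinearMap.finrank_le_finrank_of_surjective hsurj)
  exact ⟨(LinearMap.injective_iff_surjective_of_finrank_eq_finrank heq).2 hsurj, hsurj⟩

end

end Triality

namespace Triality

noncomputable section

variable {F : Type u} [Field F] {S : Type v} [AddCommGroup S] [Module F S] {n : QuadraticForm F S}
variable {R : Type u} [CommRing R] [Algebra F R]

/-! ### The homomorphism `α₀` is bijective -/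

theorem alpha0_bilin (hn : Nonsingular n) (star : SymmetricComposition n) (x y : R ⊗[F] S) :
    alpha0 hn star R ((CliffordAlgebra.even.ι (scalar n R)).bilin x y) =
      algebraMap F R (star.mult⁻¹ : Fˣ) •
        ((star.mulR R).flip x ∘ₗ star.mulR R y, star.mulR R x ∘ₗ (star.mulR R).flip y) := by
  simp [alpha0]

/-- The even Clifford algebra over `R` is spanned by that over `F`. -/
theorem span_inclC0 (n : QuadraticForm F S) :
    Submodule.span R (Set.range (inclC0 n R)) = ⊤ := by
  have hmul : ∀ a ∈ Submodule.span R (Set.range (inclC0 n R)),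
      ∀ b ∈ Submodule.span R (Set.range (inclC0 n R)),
      a * b ∈ Submodule.span R (Set.range (inclC0 n R)) := by
    intro a ha b hb
    induction ha using Submodule.span_induction with
    | zero => rw [zero_mul]; exact zero_mem _
    | add x y _ _ hx hy => rw [add_mul]; exact add_mem hx hy
    | smul c x _ hx => rw [smul_mul_assoc]; exact Submodule.smul_mem _ c hx
    | mem x hx =>
      induction hb using Submodule.span_induction with
      | zero => rw [mul_zero]; exact zero_mem _
      | add x y _ _ hx hy => rw [mul_add]; exact add_mem hx hy
      | smul c x _ hx => rw [mul_smul_comm]; exact Submodule.smul_mem _ c hx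
      | mem y hy =>
        obtain ⟨x, rfl⟩ := hx
        obtain ⟨y, rfl⟩ := hy
        exact Submodule.subset_span ⟨x * y, map_mul _ _ _⟩
  have hbilin : ∀ x y : R ⊗[F] S, (CliffordAlgebra.even.ι (scalar n R)).bilin x y ∈
      Submodule.span R (Set.range (inclC0 n R)) := by
    intro x y
    induction x with
    | zero => simp
    | add x x' hx hx' => rw [map_add]; exact add_mem hx hx'
    | tmul r x =>
      induction y with
      | zero => simp
      | add y y' hy hy' => rw [map_add]; exact add_mem hy hy'
      | tmul s y =>
        have e : ∀ (r : R) (x : S), r ⊗ₜ[F] x = r • ((1 : R) ⊗ₜ[F] x) := fun r x => by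
          simp [TensorProduct.smul_tmul']
        rw [e r, e s, map_smul, map_smul, LinearMap.smul_apply]
        exact Submodule.smul_mem _ _ (Submodule.smul_mem _ _
          (Submodule.subset_span ⟨_, inclC0_bilin x y⟩))
  refine eq_top_iff.2 fun z _ => ?_
  obtain ⟨z, hz⟩ := z
  induction z, hz using CliffordAlgebra.even_induction with
  | algebraMap r =>
    have h : r • (1 : C0 n R) ∈ Submodule.span R (Set.range (inclC0 n R)) :=
      Submodule.smul_mem _ r (Submodule.subset_span ⟨1, map_one (inclC0 n R)⟩)
    rw [← Algebra.algebraMap_eq_smul_one] at h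
    exact h
  | add x y hx hy ihx ihy => exact add_mem (ihx trivial) (ihy trivial)
  | ι_mul_ι_mul m₁ m₂ x hx ih => exact hmul _ (hbilin m₁ m₂) _ (ih trivial)

/-- Extension of scalars of endomorphisms, as an algebra homomorphism. -/
def endR (F : Type u) [Field F] (S : Type v) [AddCommGroup S] [Module F S] (R : Type u) [CommRing R]
    [Algebra F R] : Module.End F S →ₐ[F] Module.End R (R ⊗[F] S) :=
  ((LinearMap.tensorProductEnd F R S).restrictScalars F).comp Algebra.TensorProduct.includeRight

theorem endR_apply (a : Module.End F S) :
    endR F S R a = LinearMap.tensorProductEnd F R S (1 ⊗ₜ a) := rfl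

@[simp] theorem endR_tmul (a : Module.End F S) (r : R) (x : S) :
    endR F S R a (r ⊗ₜ x) = r ⊗ₜ a x := by
  rw [endR_apply, tensorProductEnd_tmul, one_mul]

/-- Each `vec x` exchanges the copies of S, so even elements act by diagonal blocks. Those of `vec
m₁ * vec m₂` are λ⁻¹ r ℓ and λ⁻¹ ℓ r, exactly the components of α₀. The pair `p` is chosen before
`R`, so it describes α₀ over all algebras at once. -/
theorem SymmetricComposition.rep_even (hn : Nonsingular n) (star : SymmetricComposition n)
    (z : CliffordAlgebra.even n) : ∃ p : Module.End F S × Module.End F S,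
      star.rep hn z = LinearMap.prodMap p.1 p.2 ∧
      ∀ (R : Type u) [CommRing R] [Algebra F R], alpha0 hn star R (inclC0 n R z) =
        (endR F S R p.1, endR F S R p.2) := by
  let A (R : Type u) [CommRing R] [Algebra F R] :=
    ((alpha0 hn star R).restrictScalars F).comp (inclC0 n R)
  let B (R : Type u) [CommRing R] [Algebra F R] :=
    ((endR F S R).comp (AlgHom.fst F (Module.End F S) (Module.End F S))).prod
      ((endR F S R).comp (AlgHom.snd F (Module.End F S) (Module.End F S)))
  let C := (star.rep hn).comp (CliffordAlgebra.even n).val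
  let D := LinearMap.prodMapAlgHom F S S
  suffices h : ∃ p, C z = D p ∧ ∀ (R : Type u) [CommRing R] [Algebra F R], A R z = B R p from h
  obtain ⟨z, hz⟩ := z
  induction z, hz using CliffordAlgebra.even_induction with
  | algebraMap r =>
    exact ⟨algebraMap F _ r, (C.commutes r).trans (D.commutes r).symm, fun R _ _ =>
      ((A R).commutes r).trans ((B R).commutes r).symm⟩
  | add x y hx hy ihx ihy =>
    obtain ⟨p, hp, hp'⟩ := ihx
    obtain ⟨q, hq, hq'⟩ := ihy
    refine ⟨p + q, ?_, fun R _ _ => ?_⟩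
    · rw [map_add D, ← hp, ← hq, ← map_add C]; rfl
    · rw [map_add (B R), ← hp', ← hq', ← map_add (A R)]; rfl
  | ι_mul_ι_mul m₁ m₂ x hx ih =>
    obtain ⟨p, hp, hp'⟩ := ih
    let w := (CliffordAlgebra.even.ι n).bilin m₁ m₂
    let q : Module.End F S × Module.End F S := ((star.mult⁻¹ : Fˣ) : F) •
      (star.mul.flip m₁ ∘ₗ star.mul m₂, star.mul m₁ ∘ₗ star.mul.flip m₂)
    have hq : C w = D q := by
      change star.rep hn (CliffordAlgebra.ι n m₁ * CliffordAlgebra.ι n m₂) = D q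
      rw [map_mul (star.rep hn), star.rep_ι, star.rep_ι]
      refine LinearMap.ext fun ⟨u, v⟩ => ?_
      simp [D, q]
    have hq' : ∀ (R : Type u) [CommRing R] [Algebra F R], A R w = B R q := by
      intro R _ _
      change alpha0 hn star R (inclC0 n R w) = (endR F S R q.1, endR F S R q.2)
      rw [inclC0_bilin, alpha0_bilin]
      refine Prod.ext ?_ ?_
      · apply TensorProduct.AlgebraTensorModule.ext
        intro r x
        rw [← mul_one r, ← smul_eq_mul, ← TensorProduct.smul_tmul', map_smul, map_smul, endR_tmul]
        simp [SymmetricComposition.mulR_tmul, q]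
      · apply TensorProduct.AlgebraTensorModule.ext
        intro r x
        rw [← mul_one r, ← smul_eq_mul, ← TensorProduct.smul_tmul', map_smul, map_smul, endR_tmul]
        simp [SymmetricComposition.mulR_tmul, q]
    refine ⟨q * p, ?_, fun R _ _ => ?_⟩
    · rw [map_mul D, ← hp, ← hq, ← map_mul C]; rfl
    · rw [map_mul (B R), ← hp', ← hq', ← map_mul (A R)]; rfl

/-- Odd elements have zero diagonal blocks. Hence a preimage of a block-diagonal operator may be
replaced by its even part. -/
theorem SymmetricComposition.rep_odd (hn : Nonsingular n) (star : SymmetricComposition n)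
    (z : CliffordAlgebra n) (hz : z ∈ CliffordAlgebra.evenOdd n 1) (u : S) :
    (star.rep hn z (u, 0)).1 = 0 ∧ (star.rep hn z (0, u)).2 = 0 := by
  induction z, hz using CliffordAlgebra.odd_induction generalizing u with
  | ι v => simp
  | add x y hx hy ihx ihy =>
    simp [ihx u, ihy u]
  | ι_mul_ι_mul m₁ m₂ x hx ih =>
    obtain ⟨h₁, h₂⟩ := ih u
    have e₁ : star.rep hn x (u, 0) = (0, (star.rep hn x (u, 0)).2) := Prod.ext h₁ rfl
    have e₂ : star.rep hn x (0, u) = ((star.rep hn x (0, u)).1, 0) := Prod.ext rfl h₂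
    simp only [map_mul, rep_ι, Module.End.mul_apply]
    rw [e₁, e₂]
    simp

/-- Every pair of endomorphisms of `S` comes from exactly one element of `C₀(S, n)`. -/
theorem SymmetricComposition.exists_even_equiv (hdim : Module.finrank F S = 8)
    (hn : Nonsingular n) (star : SymmetricComposition n) :
    ∃ γ : CliffordAlgebra.even n ≃ₗ[F] Module.End F S × Module.End F S,
      ∀ (R : Type u) [CommRing R] [Algebra F R] (z), alpha0 hn star R (inclC0 n R z) =
        (endR F S R (γ z).1, endR F S R (γ z).2) := by
  choose γ hγ hγ' using star.rep_even hn
  have hD : Function.Injective (LinearMap.prodMapAlgHom F S S) := by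
    intro p q h
    have h' : ∀ u v, (p.1 u, p.2 v) = (q.1 u, q.2 v) := fun u v => LinearMap.congr_fun h (u, v)
    refine Prod.ext (LinearMap.ext fun u => ?_) (LinearMap.ext fun u => ?_)
    · exact congrArg Prod.fst (h' u 0)
    · exact congrArg Prod.snd (h' 0 u)
  have hlin : ∃ g : CliffordAlgebra.even n →ₗ[F] Module.End F S × Module.End F S, ∀ z, g z = γ z := by
    refine ⟨⟨⟨γ, fun x y => hD ?_⟩, fun c x => hD ?_⟩, fun _ => rfl⟩
    · rw [map_add]
      exact (hγ _).symm.trans ((map_add (star.rep hn) (x : CliffordAlgebra n) y).trans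
        (congrArg₂ (· + ·) (hγ x) (hγ y)))
    · rw [map_smul]
      exact (hγ _).symm.trans ((map_smul (star.rep hn) c (x : CliffordAlgebra n)).trans
        (congrArg (c • ·) (hγ x)))
  obtain ⟨g, hg⟩ := hlin
  have hbij := star.bijective_rep hdim hn
  have hinj : Function.Injective g := by
    intro x y h
    rw [hg, hg] at h
    exact Subtype.ext (hbij.1 (by rw [hγ, hγ, h]))
  have hsurj : Function.Surjective g := by
    intro p
    obtain ⟨z, hz⟩ := hbij.2 (LinearMap.prodMap p.1 p.2)
    have htop : z ∈ CliffordAlgebra.evenOdd n 0 ⊔ CliffordAlgebra.evenOdd n 1 := by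
      rw [(CliffordAlgebra.evenOdd_isCompl n).sup_eq_top]; trivial
    obtain ⟨z₀, h₀, z₁, h₁, rfl⟩ := Submodule.mem_sup.1 htop
    refine ⟨⟨z₀, h₀⟩, ?_⟩
    rw [hg]
    have hz₀ : star.rep hn z₀ = LinearMap.prodMap (γ ⟨z₀, h₀⟩).1 (γ ⟨z₀, h₀⟩).2 := hγ ⟨z₀, h₀⟩
    rw [map_add, hz₀] at hz
    refine Prod.ext (LinearMap.ext fun u => ?_) (LinearMap.ext fun u => ?_)
    · have h := congrArg Prod.fst (LinearMap.congr_fun hz (u, 0))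
      simpa [(star.rep_odd hn z₁ h₁ u).1] using h
    · have h := congrArg Prod.snd (LinearMap.congr_fun hz (0, u))
      simpa [(star.rep_odd hn z₁ h₁ u).2] using h
  have hg' : Function.Bijective g := ⟨hinj, hsurj⟩
  refine ⟨LinearEquiv.ofBijective g hg', fun R _ _ z => ?_⟩
  rw [hγ', ← hg]
  rfl

/-- The map β from R ⊗ (End S × End S) to C₀ is onto because C₀ over R is spanned by C₀ over F, and
α₀ ∘ β is the canonical bijection. Therefore α₀ is bijective, without first identifying C₀(R ⊗ S)
with R ⊗ C₀(S). -/
theorem bijective_alpha0 (hdim : Module.finrank F S = 8) (hn : Nonsingular n)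
    (star : SymmetricComposition n) : Function.Bijective (alpha0 hn star R) := by
  have hfin : FiniteDimensional F S := Module.finite_of_finrank_pos (by omega)
  obtain ⟨γ, hγ⟩ := star.exists_even_equiv hdim hn
  let E := LinearMap.tensorProductEnd F R S
  have hE : Function.Bijective E := bijective_tensorProductEnd
  let β : R ⊗[F] (Module.End F S × Module.End F S) →ₗ[R] C0 n R :=
    LinearMap.liftBaseChange R ((inclC0 n R).toLinearMap ∘ₗ γ.symm.toLinearMap)
  have hβ : ∀ r p, β (r ⊗ₜ p) = r • inclC0 n R (γ.symm p) := fun r p => by simp [β]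
  have hsurjβ : Function.Surjective β := by
    rw [← LinearMap.range_eq_top, eq_top_iff, ← span_inclC0, Submodule.span_le]
    rintro _ ⟨z, rfl⟩
    exact ⟨1 ⊗ₜ γ z, by rw [hβ, LinearEquiv.symm_apply_apply, one_smul]⟩
  let δ := TensorProduct.prodRight F R R (Module.End F S) (Module.End F S)
  have hcomp : (alpha0 hn star R).toLinearMap ∘ₗ β =
      (E.toLinearMap.prodMap E.toLinearMap) ∘ₗ δ.toLinearMap := by
    apply TensorProduct.AlgebraTensorModule.ext
    intro r p
    obtain ⟨a, b⟩ := p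
    have e : ∀ a : Module.End F S, E (r ⊗ₜ a) = r • endR F S R a := fun a => by
      rw [endR_apply, ← map_smul, TensorProduct.smul_tmul', smul_eq_mul, mul_one]
    change alpha0 hn star R (β (r ⊗ₜ (a, b))) = (E.toLinearMap.prodMap E.toLinearMap) (δ (r ⊗ₜ (a, b)))
    rw [hβ, map_smul, hγ, LinearEquiv.apply_symm_apply, TensorProduct.prodRight_tmul,
      LinearMap.prodMap_apply]
    change _ = (E (r ⊗ₜ a), E (r ⊗ₜ b))
    rw [e, e, Prod.smul_mk]
  have hbij : Function.Bijective ((E.toLinearMap.prodMap E.toLinearMap) ∘ₗ δ.toLinearMap) :=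
    (hE.prodMap hE).comp δ.bijective
  rw [← hcomp] at hbij
  have hbij' : Function.Bijective (alpha0 hn star R ∘ β) := hbij
  refine ⟨fun x y h => ?_, hbij'.2.of_comp⟩
  obtain ⟨x, rfl⟩ := hsurjβ x
  obtain ⟨y, rfl⟩ := hsurjβ y
  exact congrArg β (hbij'.1 h)

/-- `α₀` maps the center of `C₀(S, n)` to pairs of scalars. -/
theorem alpha0_center (hdim : Module.finrank F S = 8) (hn : Nonsingular n)
    (star : SymmetricComposition n) {z : CliffordAlgebra.even n}
    (hz : z ∈ Subalgebra.center F (CliffordAlgebra.even n)) :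
    ∃ r s : R, ∀ x, (alpha0 hn star R (inclC0 n R z)).1 x = r • x ∧
      (alpha0 hn star R (inclC0 n R z)).2 x = s • x := by
  have hcomm : ∀ c : C0 n R, c * inclC0 n R z = inclC0 n R z * c := by
    intro c
    have hc : c ∈ Submodule.span R (Set.range (inclC0 n R)) := by rw [span_inclC0]; trivial
    induction hc using Submodule.span_induction with
    | zero => rw [zero_mul, mul_zero]
    | add x y _ _ hx hy => rw [add_mul, mul_add, hx, hy]
    | smul r x _ hx => rw [smul_mul_assoc, mul_smul_comm, hx]
    | mem x hx =>
      obtain ⟨y, rfl⟩ := hx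
      rw [← map_mul, ← map_mul, Subalgebra.mem_center_iff.1 hz y]
  -- As α₀ is onto, the image of z commutes with all pairs, so each of its components is a scalar.
  have hcomm' : ∀ p, p * alpha0 hn star R (inclC0 n R z) = alpha0 hn star R (inclC0 n R z) * p := by
    intro p
    obtain ⟨c, rfl⟩ := (bijective_alpha0 hdim hn star).2 p
    rw [← map_mul, ← map_mul, hcomm]
  obtain ⟨r, hr⟩ := exists_eq_smul (alpha0 hn star R (inclC0 n R z)).1 fun a x =>
    (LinearMap.congr_fun (congrArg Prod.fst (hcomm' (endR F S R a, 1))) x).symm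
  obtain ⟨s, hs⟩ := exists_eq_smul (alpha0 hn star R (inclC0 n R z)).2 fun a x =>
    (LinearMap.congr_fun (congrArg Prod.snd (hcomm' (1, endR F S R a))) x).symm
  exact ⟨r, s, fun x => ⟨hr x, hs x⟩⟩

end

end Triality

namespace Triality

noncomputable section

variable {F : Type u} [Field F] {S : Type v} [AddCommGroup S] [Module F S] {n : QuadraticForm F S}
variable {R : Type u} [CommRing R] [Algebra F R]
variable {R₁ : Type u} [CommRing R₁] [Algebra F R₁] {R₂ : Type u} [CommRing R₂] [Algebra F R₂]

/-! ### Triples of similarities -/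

theorem Similitude.polar_map (f : Similitude n R) (x y : R ⊗[F] S) :
    QuadraticMap.polar (scalar n R) (f.toEquiv x) (f.toEquiv y) =
      (f.mult : R) * QuadraticMap.polar (scalar n R) x y := by
  simp only [QuadraticMap.polar, ← map_add, f.map_form]
  ring

/-- `f`, `g`, `h` are related triples: `c f(x ⋆ y) = g(x) ⋆ h(y)` for a unit `c`. -/
def Triple (star : SymmetricComposition n) (f g h : Similitude n R) : Prop :=
  ∃ c : Rˣ, ∀ x y, (c : R) • f.toEquiv (star.mulR R x y) =
    star.mulR R (g.toEquiv x) (h.toEquiv y)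

/-- Pair with g(x): b(g(x), h(y) ⋆ f(z)) = b(g(x) ⋆ h(y), f(z)) = c μ(f) b(x ⋆ y, z) = c μ(f) b(x, y
⋆ z), and b(x, y ⋆ z) = μ(g)⁻¹ b(g(x), g(y ⋆ z)). Nondegeneracy and surjectivity of g yield the new
constant c μ(f) μ(g)⁻¹. -/
theorem Triple.rotate [FiniteDimensional F S] (hn : Nonsingular n) {star : SymmetricComposition n}
    {f g h : Similitude n R} (H : Triple star f g h) : Triple star g h f := by
  obtain ⟨c, hc⟩ := H
  refine ⟨g.mult⁻¹ * c * f.mult, fun y z => ?_⟩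
  rw [← sub_eq_zero]
  refine hn.eq_zero_of_polar fun w => ?_
  obtain ⟨x, rfl⟩ := g.toEquiv.surjective w
  rw [QuadraticMap.polar_sub_left, QuadraticMap.polar_smul_left, g.polar_map,
    QuadraticMap.polar_comm _ (star.mulR R (h.toEquiv y) (f.toEquiv z)), ← star.polar_mulR, ← hc,
    QuadraticMap.polar_smul_left, f.polar_map, QuadraticMap.polar_comm _ (star.mulR R y z),
    star.polar_mulR, sub_eq_zero]
  simp only [smul_eq_mul, Units.val_mul]
  linear_combination (c : R) * f.mult * QuadraticMap.polar (scalar n R) x (star.mulR R y z) *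
    g.mult.inv_mul

theorem Triple.op {star : SymmetricComposition n} {f g h : Similitude n R}
    (H : Triple star f g h) : Triple star.op f h g := by
  obtain ⟨c, hc⟩ := H
  exact ⟨c, fun x y => by rw [star.mulR_op, star.mulR_op, hc]⟩

theorem Triple.mul {star : SymmetricComposition n} {f g h f' g' h' : Similitude n R}
    (H : Triple star f g h) (H' : Triple star f' g' h') :
    Triple star (f.mul f') (g.mul g') (h.mul h') := by
  obtain ⟨c, hc⟩ := H
  obtain ⟨c', hc'⟩ := H'
  refine ⟨c * c', fun x y => ?_⟩
  simp only [Similitude.mul, LinearEquiv.trans_apply]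
  rw [← hc, ← hc', map_smul, smul_smul, Units.val_mul]

theorem Triple.base {star : SymmetricComposition n} {f g h : Similitude n R₁}
    (H : Triple star f g h) (w : R₁ →ₐ[F] R₂) :
    Triple star (f.base w) (g.base w) (h.base w) := by
  obtain ⟨c, hc⟩ := H
  refine ⟨Units.map (w : R₁ →* R₂) c, fun x y => ?_⟩
  have h₁ : ∀ x y, w (c : R₁) • (f.base w).toEquiv (star.mulR R₂ (push S w x) (push S w y)) =
      star.mulR R₂ ((g.base w).toEquiv (push S w x)) ((h.base w).toEquiv (push S w y)) := by
    intro x y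
    rw [star.mulR_push, Similitude.base_push, Similitude.base_push, Similitude.base_push,
      star.mulR_push, ← push_smul, hc]
  have h₂ : ∀ x, w (c : R₁) • (f.base w).toEquiv.toLinearMap ∘ₗ star.mulR R₂ (push S w x) =
      star.mulR R₂ ((g.base w).toEquiv (push S w x)) ∘ₗ (h.base w).toEquiv.toLinearMap :=
    fun x => push_ext w fun y => h₁ x y
  have h₃ : w (c : R₁) • (f.base w).toEquiv.toLinearMap ∘ₗ (star.mulR R₂).flip y =
      (star.mulR R₂).flip ((h.base w).toEquiv y) ∘ₗ (g.base w).toEquiv.toLinearMap :=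
    push_ext w fun x => LinearMap.congr_fun (h₂ x) y
  exact LinearMap.congr_fun h₃ x

/-- The first component of the relation `α₀ ∘ C₀(f) = (Int(g) × Int(h)) ∘ α₀`. -/
def Intertwines (star : SymmetricComposition n) (f : Similitude n R)
    (g : (R ⊗[F] S) ≃ₗ[R] (R ⊗[F] S)) : Prop :=
  ∀ x y z, star.mulR R (star.mulR R (f.toEquiv y) (g z)) (f.toEquiv x) =
    (f.mult : R) • g (star.mulR R (star.mulR R y z) x)

/-- Only the arguments of f are restricted to R₁ ⊗ S. The vector z stays over R₂, because g may
exist only there. -/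
theorem intertwines_base {star : SymmetricComposition n} {f : Similitude n R₁} (w : R₁ →ₐ[F] R₂)
    {g : (R₂ ⊗[F] S) ≃ₗ[R₂] (R₂ ⊗[F] S)}
    (H : ∀ x y z, star.mulR R₂ (star.mulR R₂ (push S w (f.toEquiv y)) (g z))
        (push S w (f.toEquiv x)) =
      w (f.mult : R₁) • g (star.mulR R₂ (star.mulR R₂ (push S w y) z) (push S w x))) :
    Intertwines star (f.base w) g := by
  let f' := (f.base w).toEquiv
  let m := star.mulR R₂
  have h₃ : ∀ x z, m.flip (f' (push S w x)) ∘ₗ m.flip (g z) ∘ₗ f'.toLinearMap =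
      w (f.mult : R₁) • g.toLinearMap ∘ₗ m.flip (push S w x) ∘ₗ m.flip z :=
    fun x z => push_ext w fun y => by
      change m (m (f' (push S w y)) (g z)) (f' (push S w x)) = _
      simp only [f', Similitude.base_push]
      exact H x y z
  have h₄ : ∀ y z, m (m (f' y) (g z)) ∘ₗ f'.toLinearMap =
      w (f.mult : R₁) • g.toLinearMap ∘ₗ m (m y z) :=
    fun y z => push_ext w fun x => LinearMap.congr_fun (h₃ x z) y
  exact fun x y z => LinearMap.congr_fun (h₄ y z) x

theorem Intertwines.base {star : SymmetricComposition n} {f g : Similitude n R₁}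
    (H : Intertwines star f g.toEquiv) (w : R₁ →ₐ[F] R₂) :
    Intertwines star (f.base w) (g.base w).toEquiv := by
  let G := (g.base w).toEquiv
  let m := star.mulR R₂
  refine intertwines_base w fun x y z => ?_
  have h₂ : m.flip (push S w (f.toEquiv x)) ∘ₗ m (push S w (f.toEquiv y)) ∘ₗ G.toLinearMap =
      w (f.mult : R₁) • G.toLinearMap ∘ₗ m.flip (push S w x) ∘ₗ m (push S w y) :=
    push_ext w fun z => by
      change m (m (push S w (f.toEquiv y)) (G (push S w z))) (push S w (f.toEquiv x)) =
        w (f.mult : R₁) • G (m (m (push S w y) (push S w z)) (push S w x))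
      simp only [m, G, star.mulR_push, Similitude.base_push]
      rw [← push_smul, H]
  exact LinearMap.congr_fun h₂ z

/-- The even Clifford algebra is generated by the products x y, and on these the two conditions
differ by the units λ and μ(f). -/
theorem mapC0_intertwines {hn : Nonsingular n} {star : SymmetricComposition n}
    {f : Similitude n R} {g : (R ⊗[F] S) ≃ₗ[R] (R ⊗[F] S)} :
    Intertwines star f g ↔
      ∀ c : C0 n R, (alpha0 hn star R (f.mapC0 c)).1 = g.conj (alpha0 hn star R c).1 := by
  have hu : algebraMap F R (star.mult : F) * algebraMap F R (star.mult⁻¹ : Fˣ) = 1 := by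
    rw [← map_mul, Units.mul_inv, map_one]
  constructor
  · intro H c
    have key : ((AlgHom.fst R _ _).comp (alpha0 hn star R)).comp f.mapC0 =
        ((g.conjAlgEquiv R : _ →ₐ[R] _).comp (AlgHom.fst R _ _)).comp (alpha0 hn star R) := by
      refine CliffordAlgebra.even.algHom_ext (scalar n R) (A := Module.End R (R ⊗[F] S)) ?_
      apply CliffordAlgebra.EvenHom.ext
      refine LinearMap.ext₂ fun x y => LinearMap.ext fun z => ?_
      obtain ⟨z, rfl⟩ := g.surjective z
      change (alpha0 hn star R (f.mapC0 ((CliffordAlgebra.even.ι (scalar n R)).bilin x y))).1 (g z) =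
        g ((alpha0 hn star R ((CliffordAlgebra.even.ι (scalar n R)).bilin x y)).1 (g.symm (g z)))
      rw [Similitude.mapC0_bilin, map_smul, alpha0_bilin, alpha0_bilin, LinearEquiv.symm_apply_apply]
      change ((f.mult⁻¹ : Rˣ) : R) • algebraMap F R (star.mult⁻¹ : Fˣ) •
        star.mulR R (star.mulR R (f.toEquiv y) (g z)) (f.toEquiv x) =
          g (algebraMap F R (star.mult⁻¹ : Fˣ) • star.mulR R (star.mulR R y z) x)
      rw [H, map_smul, smul_comm, smul_smul ((f.mult⁻¹ : Rˣ) : R), Units.inv_mul, one_smul]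
    exact congrArg (fun q => q c) key
  · intro H x y z
    have h := LinearMap.congr_fun (H ((CliffordAlgebra.even.ι (scalar n R)).bilin x y)) (g z)
    rw [Similitude.mapC0_bilin, map_smul, alpha0_bilin, alpha0_bilin] at h
    have h' : ((f.mult⁻¹ : Rˣ) : R) • algebraMap F R (star.mult⁻¹ : Fˣ) •
        star.mulR R (star.mulR R (f.toEquiv y) (g z)) (f.toEquiv x) =
          g (algebraMap F R (star.mult⁻¹ : Fˣ) • star.mulR R (star.mulR R y (g.symm (g z))) x) := h
    rw [LinearEquiv.symm_apply_apply, map_smul, smul_comm] at h'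
    have h'' := congrArg (fun x => algebraMap F R (star.mult : F) • (f.mult : R) • x) h'
    rw [smul_comm (f.mult : R), smul_smul, hu, one_smul, smul_smul (f.mult : R), Units.mul_inv,
      one_smul, smul_comm (f.mult : R), smul_smul, hu, one_smul] at h''
    exact h''

theorem Diagram.intertwines {hn : Nonsingular n} {star : SymmetricComposition n}
    {f g h : Similitude n R} (H : Diagram hn star f g h) : Intertwines star f g.toEquiv :=
  mapC0_intertwines.2 fun c => congrArg Prod.fst (H c)

section

variable [FiniteDimensional F S] [Nontrivial S]

/-- That c d = μ(f) comes from computing (f(e) ⋆ g(z)) ⋆ f(e) twice, where z = (λ n(e))⁻¹ e, so that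
(e ⋆ z) ⋆ e = e. The rotated triples give c d g(e); the norm identity gives λ μ(f) n(e) g(z) = μ(f)
g(e). -/
theorem exists_units_triple (hn : Nonsingular n) {star : SymmetricComposition n}
    {f g h : Similitude n R} (H : Triple star f g h) : ∃ c d : Rˣ, (c * d : R) = f.mult ∧
      (∀ x y, (c : R) • h.toEquiv (star.mulR R x y) =
        star.mulR R (f.toEquiv x) (g.toEquiv y)) ∧
      ∀ x y, (d : R) • g.toEquiv (star.mulR R x y) =
        star.mulR R (h.toEquiv x) (f.toEquiv y) := by
  obtain ⟨d, hd⟩ := H.rotate hn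
  obtain ⟨c, hc⟩ := (H.rotate hn).rotate hn
  refine ⟨c, d, ?_, hc, hd⟩
  obtain ⟨e, he⟩ := hn.exists_ne_zero
  have he0 : e ≠ 0 := fun h => he (by rw [h, map_zero])
  have hu : IsUnit (scalar n R (1 ⊗ₜ e)) := isUnit_scalar_one_tmul he
  obtain ⟨z, hz⟩ : ∃ z, (star.mulR R (star.mulR R (1 ⊗ₜ e) z) (1 ⊗ₜ e)) = 1 ⊗ₜ e := by
    obtain ⟨u, hu'⟩ := star.isUnit_mult.mul hu
    exact ⟨((u⁻¹ : Rˣ) : R) • (1 ⊗ₜ e), by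
      rw [star.mulR_mulR_right hn, ← hu', smul_smul, Units.mul_inv, one_smul]⟩
  have h₁ : ((c * d : R)) • g.toEquiv (1 ⊗ₜ e) = (f.mult : R) • g.toEquiv (1 ⊗ₜ e) := by
    have h₂ : star.mulR R (star.mulR R (f.toEquiv (1 ⊗ₜ e)) (g.toEquiv z)) (f.toEquiv (1 ⊗ₜ e))
        = ((c * d : R)) • g.toEquiv (1 ⊗ₜ e) := by
      rw [← hc, map_smul, LinearMap.smul_apply, ← hd, smul_smul, hz]
    have hz' := hz.symm
    rw [star.mulR_mulR_right hn] at hz'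
    rw [← h₂, star.mulR_mulR_right hn, f.map_form]
    conv_rhs => rw [hz', map_smul, smul_smul]
    congr 1
    ring
  rw [← map_smul, ← map_smul] at h₁
  exact eq_of_smul_one_tmul he0 (g.toEquiv.injective h₁)

/-- The rotated relations give (f(y) ⋆ g(z)) ⋆ f(x) = c h(y ⋆ z) ⋆ f(x) = c d g((y ⋆ z) ⋆ x) with c
d = μ(f), which is the first component. The second component of α₀ is the first one for ⋆ᵒᵖ, where h
takes the place of g. -/
theorem Triple.diagram {hn : Nonsingular n} {star : SymmetricComposition n}
    {f g h : Similitude n R} (H : Triple star f g h) : Diagram hn star f g h := by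
  obtain ⟨c, d, hcd, hc, hd⟩ := exists_units_triple hn H
  have h₁ : Intertwines star f g.toEquiv := fun x y z => by
    rw [← hc, map_smul, LinearMap.smul_apply, ← hd, smul_smul, hcd]
  have h₂ : Intertwines star.op f h.toEquiv := fun x y z => by
    simp only [star.mulR_op]
    rw [← hd, map_smul, ← hc, smul_smul, mul_comm, hcd]
  intro w
  refine Prod.ext (mapC0_intertwines.1 h₁ w) ?_
  have h₃ : (alpha0 hn star.op R (f.mapC0 w)).1 = h.toEquiv.conj (alpha0 hn star.op R w).1 :=
    mapC0_intertwines.1 h₂ w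
  have h₄ : (AlgHom.fst R _ _).comp (alpha0 hn star.op R) =
      (AlgHom.snd R _ _).comp (alpha0 hn star R) := by
    refine CliffordAlgebra.even.algHom_ext (scalar n R) (A := Module.End R (R ⊗[F] S)) ?_
    apply CliffordAlgebra.EvenHom.ext
    refine LinearMap.ext₂ fun x y => LinearMap.ext fun z => ?_
    change (alpha0 hn star.op R ((CliffordAlgebra.even.ι (scalar n R)).bilin x y)).1 z =
      (alpha0 hn star R ((CliffordAlgebra.even.ι (scalar n R)).bilin x y)).2 z
    rw [alpha0_bilin, alpha0_bilin]
    change algebraMap F R (star.mult⁻¹ : Fˣ) • star.op.mulR R (star.op.mulR R y z) x =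
      algebraMap F R (star.mult⁻¹ : Fˣ) • star.mulR R x (star.mulR R z y)
    rw [star.mulR_op, star.mulR_op]
  have h₅ : ∀ w, (alpha0 hn star.op R w).1 = (alpha0 hn star R w).2 := fun w =>
    congrArg (fun q => q w) h₄
  rwa [h₅, h₅] at h₃

/-- α₀ sends the center to pairs of scalars, which Int(g) × Int(h) fixes, and α₀ is injective. By
rotation, g and h are proper too. -/
theorem Triple.proper (hdim : Module.finrank F S = 8) (hn : Nonsingular n)
    {star : SymmetricComposition n} {f g h : Similitude n R} (H : Triple star f g h) :
    f.Proper := by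
  intro z hz
  refine (bijective_alpha0 (R := R) hdim hn star).1 ?_
  obtain ⟨r, s, hrs⟩ := alpha0_center (R := R) hdim hn star hz
  rw [H.diagram (hn := hn)]
  refine Prod.ext (LinearMap.ext fun x => ?_) (LinearMap.ext fun x => ?_)
  · change g.toEquiv ((alpha0 hn star R (inclC0 n R z)).1 (g.toEquiv.symm x)) = _
    rw [(hrs _).1, (hrs _).1, map_smul, LinearEquiv.apply_symm_apply]
  · change h.toEquiv ((alpha0 hn star R (inclC0 n R z)).2 (h.toEquiv.symm x)) = _
    rw [(hrs _).2, (hrs _).2, map_smul, LinearEquiv.apply_symm_apply]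

end

end

end Triality

namespace Triality

noncomputable section

variable {F : Type u} [Field F] {S : Type v} [AddCommGroup S] [Module F S] {n : QuadraticForm F S}
variable {R : Type u} [CommRing R] [Algebra F R]
variable {R₁ : Type u} [CommRing R₁] [Algebra F R₁] {R₂ : Type u} [CommRing R₂] [Algebra F R₂]

/-! ### Classes of similarities -/

/-- Conjugation by a similarity, as an automorphism of `R ⊗ End_F(S)`. -/
def Similitude.aut [FiniteDimensional F S] (f : Similitude n R) : AutEnd F S R :=
  let E := AlgEquiv.ofBijective (LinearMap.tensorProductEnd F R S) bijective_tensorProductEnd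
  (E.trans (f.toEquiv.conjAlgEquiv R)).trans E.symm

theorem isClass_aut [FiniteDimensional F S] (f : Similitude n R) : IsClass f.aut f := by
  intro a x
  let E := AlgEquiv.ofBijective (LinearMap.tensorProductEnd F R S) bijective_tensorProductEnd
  have h : E (f.aut a) = f.toEquiv.conjAlgEquiv R (E a) := by
    simp [Similitude.aut, E]
  change E (f.aut a) (f.toEquiv x) = f.toEquiv (E a x)
  rw [h, LinearEquiv.conjAlgEquiv_apply]
  simp

theorem IsClass.unique [FiniteDimensional F S] {φ ψ : AutEnd F S R} {f : Similitude n R}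
    (hφ : IsClass φ f) (hψ : IsClass ψ f) : φ = ψ := by
  refine AlgEquiv.ext fun a => bijective_tensorProductEnd.1 (LinearMap.ext fun x => ?_)
  obtain ⟨x, rfl⟩ := f.toEquiv.surjective x
  rw [hφ, hψ]

/-- f⁻¹ f' commutes with every endomorphism of S, so it is a scalar. -/
theorem IsClass.exists_smul {φ : AutEnd F S R} {f f' : Similitude n R}
    (hf : IsClass φ f) (hf' : IsClass φ f') : ∃ u : R, ∀ x, f'.toEquiv x = u • f.toEquiv x := by
  obtain ⟨u, hu⟩ := exists_eq_smul (f.toEquiv.symm.toLinearMap ∘ₗ f'.toEquiv.toLinearMap)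
    fun a x => by
      simp only [LinearMap.comp_apply, LinearEquiv.coe_coe]
      rw [LinearEquiv.symm_apply_eq, ← hf' (1 ⊗ₜ a) x, ← hf, LinearEquiv.apply_symm_apply]
  refine ⟨u, fun x => ?_⟩
  have := hu x
  simp only [LinearMap.comp_apply, LinearEquiv.coe_coe, LinearEquiv.symm_apply_eq, map_smul] at this
  exact this

/-- The class of `g` is determined by the class of `f`. -/
theorem Intertwines.isClass (hdim : Module.finrank F S = 8) (hn : Nonsingular n)
    {star : SymmetricComposition n} {f g f' g' : Similitude n R} {φ ψ : AutEnd F S R}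
    (H : Intertwines star f g.toEquiv) (H' : Intertwines star f' g'.toEquiv)
    (hf : IsClass φ f) (hf' : IsClass φ f') (hg : IsClass ψ g) : IsClass ψ g' := by
  have hfin : FiniteDimensional F S := Module.finite_of_finrank_pos (by omega)
  have hnt : Nontrivial S := Module.nontrivial_of_finrank_pos (R := F) (by omega)
  obtain ⟨u, hu⟩ := hf.exists_smul hf'
  obtain ⟨e, he⟩ := hn.exists_ne_zero
  have hmult : (f'.mult : R) = u * u * f.mult := by
    have h := f'.map_form (1 ⊗ₜ e)
    rw [hu, QuadraticMap.map_smul, f.map_form, smul_eq_mul, ← mul_assoc] at h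
    exact ((isUnit_scalar_one_tmul he).mul_right_cancel h).symm
  -- Since f' = u f and μ(f') = u² μ(f), the scalars cancel: C₀(f) depends only on the class of f.
  have hmapC0 : f'.mapC0 = f.mapC0 := by
    apply CliffordAlgebra.even.algHom_ext
    apply CliffordAlgebra.EvenHom.ext
    refine LinearMap.ext₂ fun x y => ?_
    change f'.mapC0 ((CliffordAlgebra.even.ι (scalar n R)).bilin x y) =
      f.mapC0 ((CliffordAlgebra.even.ι (scalar n R)).bilin x y)
    rw [Similitude.mapC0_bilin, Similitude.mapC0_bilin, hu, hu, map_smul, map_smul,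
      LinearMap.smul_apply, smul_smul, smul_smul]
    congr 1
    linear_combination (-((f'.mult⁻¹ : Rˣ) : R) * u * u) * f.mult.mul_inv +
      ((f.mult⁻¹ : Rˣ) : R) * f'.mult.inv_mul -
      ((f'.mult⁻¹ : Rˣ) : R) * ((f.mult⁻¹ : Rˣ) : R) * hmult
  intro a x
  -- Every endomorphism is the first component of some α₀(c), so conjugation by g and by g' agree
  -- everywhere.
  obtain ⟨c, hc⟩ := (bijective_alpha0 hdim hn star).2 (LinearMap.tensorProductEnd F R S a, 0)
  have h₁ := (mapC0_intertwines (hn := hn)).1 H c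
  have h₂ := (mapC0_intertwines (hn := hn)).1 H' c
  rw [hmapC0, h₁, hc] at h₂
  have h₃ : g.toEquiv (LinearMap.tensorProductEnd F R S a (g.toEquiv.symm (g'.toEquiv x))) =
      g'.toEquiv (LinearMap.tensorProductEnd F R S a (g'.toEquiv.symm (g'.toEquiv x))) :=
    LinearMap.congr_fun h₂ (g'.toEquiv x)
  rw [LinearEquiv.symm_apply_apply] at h₃
  rw [← h₃, ← hg, LinearEquiv.apply_symm_apply]

/-- The inverse is x ↦ (λ n(a))⁻¹ x ⋆ a, by the two norm identities. -/
theorem SymmetricComposition.bijective_mulR_left (star : SymmetricComposition n)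
    (hn : Nonsingular n) {a : R ⊗[F] S} (ha : IsUnit (scalar n R a)) :
    Function.Bijective (star.mulR R a) := by
  obtain ⟨u, hu⟩ := star.isUnit_mult.mul ha
  refine ⟨fun x y h => ?_, fun x => ⟨star.mulR R (((u⁻¹ : Rˣ) : R) • x) a, ?_⟩⟩
  · have h' := congrArg (fun z => ((u⁻¹ : Rˣ) : R) • star.mulR R z a) h
    simpa only [star.mulR_mulR_right hn, ← hu, smul_smul, Units.inv_mul, one_smul] using h'
  · rw [star.mulR_mulR_left hn, ← hu, smul_smul, Units.mul_inv, one_smul]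

theorem SymmetricComposition.bijective_mulR_right (star : SymmetricComposition n)
    (hn : Nonsingular n) {a : R ⊗[F] S} (ha : IsUnit (scalar n R a)) :
    Function.Bijective fun x => star.mulR R x a := by
  have h := star.op.bijective_mulR_left hn ha
  have e : ⇑(star.op.mulR R a) = fun x => star.mulR R x a := funext fun x => star.mulR_op a x
  rwa [e] at h

/-- A linear automorphism `g` that intertwines is part of a triple of similarities. -/
theorem Intertwines.exists_triple [FiniteDimensional F S] [Nontrivial S] (hn : Nonsingular n)
    {star : SymmetricComposition n} {f : Similitude n R} {g : (R ⊗[F] S) ≃ₗ[R] (R ⊗[F] S)}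
    (H : Intertwines star f g) :
    ∃ g' h : Similitude n R, g'.toEquiv = g ∧ Triple star f g' h := by
  obtain ⟨e, he⟩ := hn.exists_ne_zero
  let E : R ⊗[F] S := 1 ⊗ₜ e
  have hE : IsUnit (scalar n R E) := isUnit_scalar_one_tmul he
  have hfE : IsUnit (scalar n R (f.toEquiv E)) := by
    rw [f.map_form]; exact f.mult.isUnit.mul hE
  obtain ⟨k, hk⟩ := star.isUnit_mult.mul hE
  -- The relation h(y ⋆ z) ∼ f(y) ⋆ g(z) forces this choice up to a factor: take y = E, z = w ⋆ E
  -- and use E ⋆ (w ⋆ E) = λ n(E) w.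
  let h := LinearEquiv.ofBijective
    (star.mulR R (f.toEquiv E) ∘ₗ g.toLinearMap ∘ₗ (star.mulR R).flip E)
    ((star.bijective_mulR_left hn hfE).comp
      (g.bijective.comp (star.bijective_mulR_right hn hE)))
  have h₀ : ∀ w, h w = star.mulR R (f.toEquiv E) (g (star.mulR R w E)) := fun w => rfl
  -- Multiply (f(y) ⋆ g(z)) ⋆ f(E) = μ(f) g((y ⋆ z) ⋆ E) by f(E) on the left and cancel μ(f); here k
  -- = λ n(E).
  have h₁ : ∀ y z, h (star.mulR R y z) = (k : R) • star.mulR R (f.toEquiv y) (g z) := by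
    intro y z
    have h₂ := H E y z
    have h₃ := congrArg (star.mulR R (f.toEquiv E)) h₂
    rw [map_smul, ← h₀, star.mulR_mulR_left hn, f.map_form, mul_left_comm, mul_smul, ← hk] at h₃
    exact (f.mult.isUnit.smul_left_cancel.1 h₃).symm
  have h₂ : ∀ w x, star.mulR R (h w) (f.toEquiv x) = ((k : R) * f.mult) • g (star.mulR R w x) := by
    intro w x
    obtain ⟨z, rfl⟩ := (star.bijective_mulR_left hn hE).2 w
    rw [h₁, map_smul, LinearMap.smul_apply, H, smul_smul]
  let l : R := algebraMap F R star.mult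
  have hnE : ∀ x, scalar n R (star.mulR R E x) = k * scalar n R x := fun x => by
    rw [star.scalar_mulR, ← hk]
  -- The multiplier of g, read off from the norms of h(E) ⋆ f(x) = k μ(f) g(E ⋆ x), together with
  -- n(E ⋆ x) = k n(x).
  let r : R := ((k⁻¹ : Rˣ) : R) ^ 3 * ((f.mult⁻¹ : Rˣ) : R) * l * scalar n R (h E)
  have hg : ∀ u, scalar n R (g u) = r * scalar n R u := by
    intro u
    obtain ⟨x, rfl⟩ := (star.bijective_mulR_left hn hE).2 u
    have h₃ := congrArg (scalar n R) (h₂ E x)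
    rw [star.scalar_mulR, f.map_form, QuadraticMap.map_smul, smul_eq_mul] at h₃
    have h₄ : ((k ^ 2 * f.mult ^ 2 : Rˣ) : R) * scalar n R (g (star.mulR R E x)) =
        ((k ^ 2 * f.mult ^ 2 : Rˣ) : R) * (r * scalar n R (star.mulR R E x)) := by
      rw [hnE]
      have e : ((k ^ 2 * f.mult ^ 2 : Rˣ) : R) * (r * (k * scalar n R x)) =
          ((k ^ 3 * (k⁻¹) ^ 3 : Rˣ) : R) * ((f.mult * f.mult⁻¹ : Rˣ) : R) *
            (l * scalar n R (h E) * (f.mult * scalar n R x)) := by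
        simp only [Units.val_mul, Units.val_pow_eq_pow_val, r]
        ring
      rw [e, ← mul_pow k k⁻¹, mul_inv_cancel k, mul_inv_cancel f.mult, one_pow, Units.val_one, one_mul, one_mul,
        h₃]
      simp only [Units.val_mul, Units.val_pow_eq_pow_val]
      ring
    exact (Units.isUnit _).mul_left_cancel h₄
  -- E is in the image of g, so r divides the unit n(E).
  have hr : IsUnit r := by
    refine isUnit_of_mul_isUnit_left (y := scalar n R (g.symm E)) ?_
    rw [← hg, LinearEquiv.apply_symm_apply]
    exact hE
  obtain ⟨r', hr'⟩ := hr
  have hh : ∀ w, scalar n R (h w) = ((k ^ 2 * f.mult * r' : Rˣ) : R) * scalar n R w := by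
    intro w
    obtain ⟨z, rfl⟩ := (star.bijective_mulR_left hn hE).2 w
    rw [h₁, hnE, QuadraticMap.map_smul, star.scalar_mulR, f.map_form, hg, ← hr']
    simp only [Units.val_mul, Units.val_pow_eq_pow_val, smul_eq_mul]
    rw [hk]
    ring
  let g' : Similitude n R := ⟨g, r', fun x => by rw [hr', hg]⟩
  let h' : Similitude n R := ⟨h, _, hh⟩
  have H' : Triple star h' f g' := ⟨k⁻¹, fun x y => by
    change ((k⁻¹ : Rˣ) : R) • h (star.mulR R x y) = _
    rw [h₁, smul_smul, Units.inv_mul, one_smul]⟩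
  exact ⟨g', h', rfl, H'.rotate hn⟩

end

end Triality

namespace Triality

noncomputable section

/-! ### Automorphisms of matrix algebras are locally inner -/

section SkolemNoether

variable {ι : Type} [Fintype ι] [DecidableEq ι] {R : Type u} [CommRing R]

/-- The matrix with columns `θ(E_{k o}) w`. -/
def conjMatrix (θ : Matrix ι ι R →ₐ[R] Matrix ι ι R) (o : ι) {B : Type u} [CommRing B] [Algebra R B]
    (w : ι → B) : Matrix ι ι B :=
  Matrix.of fun i k => ((θ (Matrix.single k o 1)).map (algebraMap R B)).mulVec w i

variable (θ : Matrix ι ι R →ₐ[R] Matrix ι ι R) (o : ι) {B : Type u} [CommRing B] [Algebra R B]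

/-- From a Eₖₒ = ∑ aₗₖ Eₗₒ: θ(a) transforms the columns as a transforms the standard basis. -/
theorem conjMatrix_mul (w : ι → B) (a : Matrix ι ι R) :
    (θ a).map (algebraMap R B) * conjMatrix θ o w = conjMatrix θ o w * a.map (algebraMap R B) := by
  ext i k
  have h₁ : a * Matrix.single k o 1 = ∑ l, a l k • Matrix.single l o (1 : R) := by
    ext p q
    simp [Matrix.sum_apply, Matrix.mul_apply, Matrix.single_apply, ite_and, eq_comm]
  have h₂ : ((θ a * θ (Matrix.single k o 1)).map (algebraMap R B)).mulVec w i =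
      ∑ l, algebraMap R B (a l k) * ((θ (Matrix.single l o 1)).map (algebraMap R B)).mulVec w i := by
    rw [← map_mul, h₁, map_sum]
    simp only [map_smul, Matrix.mulVec, dotProduct, Matrix.map_apply, Matrix.sum_apply,
      Matrix.smul_apply, map_sum, smul_eq_mul, map_mul, Finset.sum_mul, Finset.mul_sum]
    rw [Finset.sum_comm]
    simp only [mul_assoc]
  rw [Matrix.map_mul, ← Matrix.mulVec_mulVec] at h₂
  rw [Matrix.mul_apply, Matrix.mul_apply]
  refine h₂.trans (Finset.sum_congr rfl fun l _ => ?_)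
  rw [mul_comm]
  rfl

theorem conjMatrix_map {B' : Type u} [CommRing B'] [Algebra R B'] (f : B →ₐ[R] B') (w : ι → B) :
    conjMatrix θ o (f ∘ w) = (conjMatrix θ o w).map f := by
  ext i k
  simp [conjMatrix, Matrix.mulVec, dotProduct]

/-- Over K, θ(Eₒₒ) ≠ 0, because Eₖₖ = Eₖₒ Eₒₒ Eₒₖ and the Eₖₖ sum to 1. Choose a standard vector w
with θ(Eₒₒ) w ≠ 0. If c is in the kernel of the matrix, intertwining with Eₒₖ gives cₖ θ(Eₒₒ) w = 0,
so every cₖ vanishes. -/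
theorem exists_det_conjMatrix_ne_zero (K : Type u) [Field K] [Algebra R K] :
    ∃ w : ι → K, (conjMatrix θ o w).det ≠ 0 := by
  have h₀ : (θ (Matrix.single o o 1)).map (algebraMap R K) ≠ 0 := by
    intro h
    have h₁ : ∀ k : ι, (θ (Matrix.single k k 1)).map (algebraMap R K) = 0 := by
      intro k
      have : Matrix.single k k (1 : R) =
          Matrix.single k o 1 * Matrix.single o o 1 * Matrix.single o k 1 := by simp
      rw [this, map_mul, map_mul, Matrix.map_mul, Matrix.map_mul, h, mul_zero, zero_mul]
    have h₂ : (θ 1).map (algebraMap R K) = 0 := by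
      have : (1 : Matrix ι ι R) = ∑ k, Matrix.single k k 1 := by
        ext p q
        simp [Matrix.sum_apply, Matrix.single_apply, Matrix.one_apply, ite_and]
      rw [this, map_sum]
      change (algebraMap R K).mapMatrix _ = 0
      rw [map_sum]
      exact Finset.sum_eq_zero fun k _ => h₁ k
    rw [map_one] at h₂
    have h₃ := congrFun (congrFun h₂ o) o
    simp at h₃
  obtain ⟨i, j, hij⟩ : ∃ i j, algebraMap R K (θ (Matrix.single o o 1) i j) ≠ 0 := by
    by_contra! h
    exact h₀ (by ext i j; exact h i j)
  refine ⟨Pi.single j 1, fun hdet => ?_⟩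
  obtain ⟨c, hc, hc'⟩ := Matrix.exists_mulVec_eq_zero_iff.2 hdet
  obtain ⟨k, hk⟩ := Function.ne_iff.1 hc
  have h₁ := congrArg (fun m => Matrix.mulVec m c)
    (conjMatrix_mul θ o (Pi.single j (1 : K)) (Matrix.single o k 1))
  simp only [← Matrix.mulVec_mulVec, hc', Matrix.mulVec_zero] at h₁
  have h₂ : ((Matrix.single o k (1 : R)).map (algebraMap R K)).mulVec c = Pi.single o (c k) := by
    ext p
    by_cases hp : o = p
    · simp [Matrix.mulVec, dotProduct, hp, Matrix.single_apply, apply_ite (algebraMap R K)]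
    · simp [Matrix.mulVec, dotProduct, hp, Ne.symm hp]
  rw [h₂] at h₁
  have h₃ := congrFun h₁.symm i
  rw [Matrix.mulVec_single] at h₃
  simp [conjMatrix, hij] at h₃
  exact hk h₃

/-- An endomorphism of a matrix algebra is inner after a faithfully flat extension. -/
theorem exists_cover_conj {F : Type u} [Field F] [Algebra F R] [Nonempty ι] :
    ∃ (B : Type u) (_ : CommRing B) (_ : Algebra F B) (c : R →ₐ[F] B), IsCover c ∧
      ∃ G : (Matrix ι ι B)ˣ, ∀ a : Matrix ι ι R,
        (θ a).map c * (G : Matrix ι ι B) = (G : Matrix ι ι B) * a.map c := by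
  let o : ι := Classical.arbitrary ι
  -- The vector w is taken generic, with the variables as coordinates, and the determinant is
  -- inverted.
  let d : MvPolynomial ι R := (conjMatrix θ o (MvPolynomial.X : ι → MvPolynomial ι R)).det
  let B := Localization.Away d
  let c : R →ₐ[F] B := IsScalarTower.toAlgHom F R B
  have hflat : Module.Flat R B := by
    have : Module.Flat (MvPolynomial ι R) B := IsLocalization.flat B (Submonoid.powers d)
    exact Module.Flat.trans R (MvPolynomial ι R) B
  have hfp : Algebra.FinitePresentation R B := by
    have : Algebra.FinitePresentation (MvPolynomial ι R) B := inferInstance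
    exact Algebra.FinitePresentation.trans R (MvPolynomial ι R) B
  have hff : Module.FaithfullyFlat R B := by
    -- Every fibre is nonempty: over the residue field of p, some w has nonzero determinant, and
    -- specializing the variables to it defines a homomorphism from B.
    refine Module.FaithfullyFlat.of_comap_surjective fun p => ?_
    let K := p.asIdeal.ResidueField
    obtain ⟨w, hw⟩ := exists_det_conjMatrix_ne_zero θ o K
    let f : MvPolynomial ι R →ₐ[R] K := MvPolynomial.aeval w
    have hf : f d = (conjMatrix θ o w).det := by
      have : f ∘ MvPolynomial.X = w := funext fun i => MvPolynomial.aeval_X w i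
      rw [← this, conjMatrix_map]
      exact AlgHom.map_det f _
    have hu : IsUnit ((f : MvPolynomial ι R →+* K) d) := IsUnit.mk0 _ (by
      change f d ≠ 0
      rwa [hf])
    let g : B →+* K := IsLocalization.Away.lift d hu
    have hg : g.comp (algebraMap R B) = algebraMap R K := by
      ext r
      rw [RingHom.comp_apply, IsScalarTower.algebraMap_apply R (MvPolynomial ι R) B,
        IsLocalization.Away.lift_eq]
      exact f.commutes r
    refine ⟨PrimeSpectrum.comap g ⊥, ?_⟩
    rw [← PrimeSpectrum.comap_comp_apply, hg]
    ext1
    exact Ideal.ker_algebraMap_residueField p.asIdeal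
  refine ⟨B, inferInstance, inferInstance, c,
    ⟨RingHom.faithfullyFlat_algebraMap_iff.2 hff, RingHom.finitePresentation_algebraMap.2 hfp⟩, ?_⟩
  let G := conjMatrix θ o (fun i => algebraMap (MvPolynomial ι R) B (MvPolynomial.X i))
  have hG : IsUnit G := by
    have : G = (conjMatrix θ o MvPolynomial.X).map (IsScalarTower.toAlgHom R (MvPolynomial ι R) B) :=
      conjMatrix_map θ o (IsScalarTower.toAlgHom R (MvPolynomial ι R) B) MvPolynomial.X
    rw [Matrix.isUnit_iff_isUnit_det, this]
    have h := IsLocalization.Away.algebraMap_isUnit (S := B) d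
    rwa [show algebraMap (MvPolynomial ι R) B d = _ from
      AlgHom.map_det (IsScalarTower.toAlgHom R (MvPolynomial ι R) B) _] at h
  exact ⟨hG.unit, fun a => conjMatrix_mul θ o _ a⟩

end SkolemNoether

end

end Triality

namespace Triality

noncomputable section

variable {F : Type u} [Field F] {S : Type v} [AddCommGroup S] [Module F S] {n : QuadraticForm F S}
variable {R : Type u} [CommRing R] [Algebra F R]
variable {R₁ : Type u} [CommRing R₁] [Algebra F R₁] {R₂ : Type u} [CommRing R₂] [Algebra F R₂]

/-! ### Proper similarities are locally part of a triple -/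

/-- An endomorphism of `End_R(R ⊗ S)` is conjugation by a linear automorphism after a covering. -/
theorem exists_cover_conj_end (hdim : Module.finrank F S = 8)
    (θ : Module.End R (R ⊗[F] S) →ₐ[R] Module.End R (R ⊗[F] S)) :
    ∃ (B : Type u) (_ : CommRing B) (_ : Algebra F B) (c : R →ₐ[F] B), IsCover c ∧
      ∃ g : (B ⊗[F] S) ≃ₗ[B] (B ⊗[F] S), ∀ T x, pushEnd c (θ T) (g x) = g (pushEnd c T x) := by
  have hfin : FiniteDimensional F S := Module.finite_of_finrank_pos (by omega)
  let s := Module.finBasisOfFinrankEq F S hdim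
  let b (B : Type u) [CommRing B] [Algebra F B] : Module.Basis (Fin 8) B (B ⊗[F] S) :=
    Algebra.TensorProduct.basis B s
  have hb : ∀ (B : Type u) [CommRing B] [Algebra F B] (i), b B i = 1 ⊗ₜ s i := fun B _ _ i =>
    Algebra.TensorProduct.basis_apply s i
  let M : Module.End R (R ⊗[F] S) ≃ₐ[R] Matrix (Fin 8) (Fin 8) R :=
    LinearMap.toMatrixAlgEquiv (b R)
  obtain ⟨B, _, _, c, hc, G, hG⟩ := exists_cover_conj (F := F)
    ((M.toAlgHom.comp θ).comp M.symm.toAlgHom)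
  let N : Matrix (Fin 8) (Fin 8) B ≃ₐ[B] Module.End B (B ⊗[F] S) := Matrix.toLinAlgEquiv (b B)
  have hpush : ∀ T, pushEnd c T = N ((M T).map c) := by
    intro T
    refine (b B).ext fun i => ?_
    have e : ∀ j, b B j = push S c (b R j) := fun j => by rw [hb, hb, push_tmul, map_one]
    have h₁ : T (b R i) = ∑ j, M T j i • b R j := by
      conv_lhs => rw [← (b R).sum_repr (T (b R i))]
      simp only [M, LinearMap.toMatrixAlgEquiv_apply]
    rw [Matrix.toLinAlgEquiv_self, e i, pushEnd_push, h₁, map_sum]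
    exact Finset.sum_congr rfl fun j _ => by rw [push_smul, ← e, Matrix.map_apply]
  let U : (Module.End B (B ⊗[F] S))ˣ := Units.map (N : Matrix (Fin 8) (Fin 8) B →* _) G
  refine ⟨B, inferInstance, inferInstance, c, hc,
    LinearMap.GeneralLinearGroup.generalLinearEquiv B _ U, fun T x => ?_⟩
  have h := congrArg N (hG (M T))
  rw [map_mul, map_mul] at h
  have h' := LinearMap.congr_fun h x
  have e : ((M.toAlgHom.comp θ).comp M.symm.toAlgHom) (M T) = M (θ T) := by
    change M (θ (M.symm (M T))) = _
    rw [AlgEquiv.symm_apply_apply]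
  rw [e, ← hpush, ← hpush] at h'
  exact h'

theorem pushEnd_smul (w : R₁ →ₐ[F] R₂) (r : R₁) (f : Module.End R₁ (R₁ ⊗[F] S)) :
    pushEnd w (r • f) = w r • pushEnd w f :=
  push_ext w fun x => by
    rw [pushEnd_push, LinearMap.smul_apply, push_smul, LinearMap.smul_apply, pushEnd_push]

theorem endR_injective [Nontrivial R] : Function.Injective (endR F S R) := by
  intro a b h
  refine LinearMap.ext fun x => ?_
  have h₁ := LinearMap.congr_fun h (1 ⊗ₜ x)
  rw [endR_tmul, endR_tmul] at h₁
  have h₂ : Function.Injective (TensorProduct.mk F R S 1) :=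
    Module.FaithfullyFlat.tensorProduct_mk_injective S
  exact h₂ h₁

/-- The central idempotent of `C₀(S, n)` that `α₀` maps to `(1, 0)`. -/
theorem exists_central_idempotent (hdim : Module.finrank F S = 8) (hn : Nonsingular n)
    (star : SymmetricComposition n) : ∃ z ∈ Subalgebra.center F (CliffordAlgebra.even n),
      ∀ (R : Type u) [CommRing R] [Algebra F R], alpha0 hn star R (inclC0 n R z) = (1, 0) := by
  obtain ⟨γ, hγ⟩ := star.exists_even_equiv hdim hn
  have hz : ∀ (R : Type u) [CommRing R] [Algebra F R],
      alpha0 hn star R (inclC0 n R (γ.symm (1, 0))) = (1, 0) := fun R _ _ => by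
    rw [hγ, LinearEquiv.apply_symm_apply, map_one, map_zero]
  refine ⟨γ.symm (1, 0), Subalgebra.mem_center_iff.2 fun w => γ.injective ?_, hz⟩
  have key : alpha0 hn star F (inclC0 n F (w * γ.symm (1, 0))) =
      alpha0 hn star F (inclC0 n F (γ.symm (1, 0) * w)) := by
    rw [map_mul, map_mul, map_mul, map_mul, hz]
    refine Prod.ext ?_ ?_ <;> simp
  rw [hγ, hγ] at key
  exact Prod.ext (endR_injective (congrArg Prod.fst key)) (endR_injective (congrArg Prod.snd key))

/-- The action of `C₀(f)`, for a proper similarity `f`, on the first factor. -/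
theorem Similitude.Proper.exists_algHom (hdim : Module.finrank F S = 8) (hn : Nonsingular n)
    (star : SymmetricComposition n) {f : Similitude n R} (hf : f.Proper) :
    ∃ θ : Module.End R (R ⊗[F] S) →ₐ[R] Module.End R (R ⊗[F] S),
      ∀ c, (alpha0 hn star R (f.mapC0 c)).1 = θ (alpha0 hn star R c).1 := by
  let e := AlgEquiv.ofBijective (alpha0 hn star R) (bijective_alpha0 hdim hn star)
  obtain ⟨z, hz, hz'⟩ := exists_central_idempotent hdim hn star
  -- Because C₀(f) fixes the idempotent z, applying it to c z shows that the first component of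
  -- α₀(C₀(f)(c)) depends only on that of α₀(c).
  have he : ∀ c : C0 n R, e.symm ((alpha0 hn star R c).1, 0) = c * inclC0 n R z := by
    intro c
    rw [AlgEquiv.symm_apply_eq]
    change _ = alpha0 hn star R _
    rw [map_mul, hz']
    refine Prod.ext ?_ ?_ <;> simp
  have h1 : e.symm (1, 0) = inclC0 n R z := by
    have := he 1
    rwa [map_one, one_mul] at this
  let L : Module.End R (R ⊗[F] S) →ₗ[R] Module.End R (R ⊗[F] S) :=
    LinearMap.fst R _ _ ∘ₗ (alpha0 hn star R).toLinearMap ∘ₗ f.mapC0.toLinearMap ∘ₗ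
      e.symm.toLinearMap ∘ₗ LinearMap.inl R _ _
  have hL : ∀ a, L a = (alpha0 hn star R (f.mapC0 (e.symm (a, 0)))).1 := fun a => rfl
  refine ⟨AlgHom.ofLinearMap L ?_ fun a b => ?_, fun c => ?_⟩
  · rw [hL, h1, hf z hz, hz']
  · have : ((a * b, 0) : Module.End R (R ⊗[F] S) × Module.End R (R ⊗[F] S)) = (a, 0) * (b, 0) := by
      refine Prod.ext ?_ ?_ <;> simp
    rw [hL, hL, hL, this, map_mul, map_mul, map_mul]
    rfl
  · rw [AlgHom.ofLinearMap_apply, hL, he, map_mul, hf z hz, map_mul, hz', Prod.fst_mul, mul_one]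

/-- The endomorphism θ induced on the first factor becomes conjugation by a linear g over B. Read on
the operators r_x ℓ_y, this is the intertwining relation, which makes g a member of a triple. -/
theorem Similitude.Proper.exists_cover_triple (hdim : Module.finrank F S = 8) (hn : Nonsingular n)
    (star : SymmetricComposition n) {f : Similitude n R} (hf : f.Proper) :
    ∃ (B : Type u) (_ : CommRing B) (_ : Algebra F B) (c : R →ₐ[F] B), IsCover c ∧
      ∃ g h : Similitude n B, Triple star (f.base c) g h := by
  have hfin : FiniteDimensional F S := Module.finite_of_finrank_pos (by omega)
  have hnt : Nontrivial S := Module.nontrivial_of_finrank_pos (R := F) (by omega)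
  obtain ⟨θ, hθ⟩ := hf.exists_algHom hdim hn star
  obtain ⟨B, _, _, c, hc, g, hg⟩ := exists_cover_conj_end hdim θ
  let T (x y : R ⊗[F] S) : Module.End R (R ⊗[F] S) := (star.mulR R).flip x ∘ₗ star.mulR R y
  have hT : ∀ x y z, pushEnd c (T x y) z =
      star.mulR B (star.mulR B (push S c y) z) (push S c x) := by
    intro x y z
    have : pushEnd c (T x y) = (star.mulR B).flip (push S c x) ∘ₗ star.mulR B (push S c y) :=
      push_ext c fun z => by
        rw [pushEnd_push]
        change push S c (star.mulR R (star.mulR R y z) x) =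
          star.mulR B (star.mulR B (push S c y) (push S c z)) (push S c x)
        rw [star.mulR_push, star.mulR_push]
    rw [this]
    rfl
  have hu : algebraMap F R (star.mult : F) * algebraMap F R (star.mult⁻¹ : Fˣ) = 1 := by
    rw [← map_mul, Units.mul_inv, map_one]
  have hθT : ∀ x y, T (f.toEquiv x) (f.toEquiv y) = (f.mult : R) • θ (T x y) := by
    intro x y
    have h := hθ ((CliffordAlgebra.even.ι (scalar n R)).bilin x y)
    rw [Similitude.mapC0_bilin, map_smul, alpha0_bilin, alpha0_bilin] at h
    have h' : ((f.mult⁻¹ : Rˣ) : R) • algebraMap F R (star.mult⁻¹ : Fˣ) •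
        T (f.toEquiv x) (f.toEquiv y) = θ (algebraMap F R (star.mult⁻¹ : Fˣ) • T x y) := h
    rw [map_smul, smul_comm] at h'
    have h'' := congrArg (fun x => algebraMap F R (star.mult : F) • (f.mult : R) • x) h'
    rw [smul_comm (f.mult : R), smul_smul, hu, one_smul, smul_smul (f.mult : R), Units.mul_inv,
      one_smul, smul_comm (f.mult : R), smul_smul, hu, one_smul] at h''
    exact h''
  have hI : Intertwines star (f.base c) g := intertwines_base c fun x y z => by
    rw [← hT, hθT, pushEnd_smul, LinearMap.smul_apply, hg, hT]
  obtain ⟨g', h, -, H⟩ := hI.exists_triple hn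
  exact ⟨B, inferInstance, inferInstance, c, hc, g', h, H⟩

end

end Triality

namespace Triality

noncomputable section

variable {F : Type u} [Field F] {S : Type v} [AddCommGroup S] [Module F S] {n : QuadraticForm F S}
variable {R : Type u} [CommRing R] [Algebra F R]
variable {R₁ : Type u} [CommRing R₁] [Algebra F R₁] {R₂ : Type u} [CommRing R₂] [Algebra F R₂]

/-! ### Faithfully flat descent of automorphisms -/

theorem pushAlg_injective {A : Type v} [Ring A] [Algebra F A] {c : R₁ →ₐ[F] R₂} (hc : IsCover c) :
    Function.Injective (pushAlg A c) :=
  Module.Flat.rTensor_preserves_injective_linearMap (M := A) c.toLinearMap hc.1.injective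

theorem baseAut_injective {A : Type v} [Ring A] [Algebra F A] {c : R₁ →ₐ[F] R₂} (hc : IsCover c) :
    Function.Injective
      (baseAut c : ((R₁ ⊗[F] A) ≃ₐ[R₁] (R₁ ⊗[F] A)) →* ((R₂ ⊗[F] A) ≃ₐ[R₂] (R₂ ⊗[F] A))) := by
  intro φ ψ h
  refine AlgEquiv.ext fun a => pushAlg_injective hc ?_
  rw [← baseAut_push, ← baseAut_push, h]

/-- D is R₂ ⊗ R₂ over R₁ with its two inclusions; by faithfully flat descent their equalizer is the
image of R₁. -/
theorem IsCover.exists_kernel_pair {c : R₁ →ₐ[F] R₂} (hc : IsCover c) :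
    ∃ (D : Type u) (_ : CommRing D) (_ : Algebra F D) (i j : R₂ →ₐ[F] D),
      IsCover i ∧ i.comp c = j.comp c ∧ ∀ b, i b = j b → ∃ r, c r = b := by
  let _ : Algebra R₁ R₂ := (c : R₁ →+* R₂).toAlgebra
  have : IsScalarTower F R₁ R₂ := IsScalarTower.of_algebraMap_eq fun x => (c.commutes x).symm
  have hff : Module.FaithfullyFlat R₁ R₂ := hc.1
  have hfp : Algebra.FinitePresentation R₁ R₂ := hc.2
  let i : R₂ →ₐ[F] R₂ ⊗[R₁] R₂ :=
    (Algebra.TensorProduct.includeLeft : R₂ →ₐ[R₁] R₂ ⊗[R₁] R₂).restrictScalars F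
  let j : R₂ →ₐ[F] R₂ ⊗[R₁] R₂ :=
    (Algebra.TensorProduct.includeRight : R₂ →ₐ[R₁] R₂ ⊗[R₁] R₂).restrictScalars F
  refine ⟨R₂ ⊗[R₁] R₂, inferInstance, inferInstance, i, j, ⟨?_, ?_⟩, ?_, fun b hb => ?_⟩
  · have h : Module.FaithfullyFlat R₂ (R₂ ⊗[R₁] R₂) := inferInstance
    exact RingHom.faithfullyFlat_algebraMap_iff.2 h
  · have h : Algebra.FinitePresentation R₂ (R₂ ⊗[R₁] R₂) := inferInstance
    exact RingHom.finitePresentation_algebraMap.2 h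
  · ext r
    exact (Algebra.TensorProduct.includeLeft : R₂ →ₐ[R₁] R₂ ⊗[R₁] R₂).commutes r |>.trans
      ((Algebra.TensorProduct.includeRight : R₂ →ₐ[R₁] R₂ ⊗[R₁] R₂).commutes r).symm
  · have h := (Algebra.IsEffective.of_faithfullyFlat R₁ R₂).eqLocus_includeLeft_includeRight
    have hb' : b ∈ Set.range (algebraMap R₁ R₂) := by
      rw [← h]
      exact hb
    exact hb'

/-- A is flat over the field F, so tensoring with it keeps the equalizer sequence exact. -/
theorem exists_pushAlg_eq {A : Type v} [Ring A] [Algebra F A] {D : Type u} [CommRing D]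
    [Algebra F D] {c : R₁ →ₐ[F] R₂} {i j : R₂ →ₐ[F] D} (hij : i.comp c = j.comp c)
    (h : ∀ b, i b = j b → ∃ r, c r = b) {a : R₂ ⊗[F] A} (ha : pushAlg A i a = pushAlg A j a) :
    ∃ a₀, pushAlg A c a₀ = a := by
  have hex : Function.Exact c.toLinearMap (i.toLinearMap - j.toLinearMap) := by
    intro b
    constructor
    · intro hb
      exact h b (sub_eq_zero.1 hb)
    · rintro ⟨r, rfl⟩
      exact sub_eq_zero.2 (DFunLike.congr_fun hij r)
  refine ((Module.Flat.rTensor_exact A hex) a).1 ?_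
  rw [LinearMap.rTensor_sub]
  exact sub_eq_zero.2 ha

/-- Equality of the two pullbacks places the values of ψ on R₁ ⊗ A in the equalizer, so ψ restricts
to R₁ ⊗ A. The same holds for ψ⁻¹, and all identities are checked after the injection into R₂ ⊗ A.
-/
theorem exists_baseAut_eq {A : Type v} [Ring A] [Algebra F A] {D : Type u} [CommRing D]
    [Algebra F D] {c : R₁ →ₐ[F] R₂} (hc : IsCover c) {i j : R₂ →ₐ[F] D}
    (hij : i.comp c = j.comp c) (h : ∀ b, i b = j b → ∃ r, c r = b)
    {ψ : (R₂ ⊗[F] A) ≃ₐ[R₂] (R₂ ⊗[F] A)} (hψ : baseAut i ψ = baseAut j ψ) :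
    ∃ ψ₀ : (R₁ ⊗[F] A) ≃ₐ[R₁] (R₁ ⊗[F] A), baseAut c ψ₀ = ψ := by
  have key : ∀ ψ : (R₂ ⊗[F] A) ≃ₐ[R₂] (R₂ ⊗[F] A), baseAut i ψ = baseAut j ψ →
      ∀ a : R₁ ⊗[F] A, ∃ a₀, pushAlg A c a₀ = ψ (pushAlg A c a) := by
    intro ψ hψ a
    refine exists_pushAlg_eq hij h ?_
    rw [← baseAut_push, ← baseAut_push, ← pushAlg_comp, ← pushAlg_comp, hij, hψ]
  have hinj := pushAlg_injective (A := A) hc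
  choose p hp using key ψ hψ
  choose q hq using key ψ⁻¹ (by rw [map_inv, map_inv, hψ])
  let θ : R₁ ⊗[F] A →ₐ[R₁] R₁ ⊗[F] A := AlgHom.ofLinearMap
    { toFun := p
      map_add' := fun a b => hinj (by rw [hp, map_add, map_add, map_add, hp, hp])
      map_smul' := fun r a => hinj (by
        rw [hp, pushAlg_smul, map_smul, RingHom.id_apply, pushAlg_smul, hp]) }
    (hinj (by
      change pushAlg A c (p 1) = _
      rw [hp, map_one, map_one]))
    (fun a b => hinj (by
      change pushAlg A c (p (a * b)) = pushAlg A c (p a * p b)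
      rw [hp, map_mul, map_mul, map_mul, hp, hp]))
  have hθ : ∀ a, pushAlg A c (θ a) = ψ (pushAlg A c a) := hp
  have hbij : Function.Bijective θ := by
    refine ⟨fun a b hab => hinj (ψ.injective ?_), fun a => ⟨q a, hinj ?_⟩⟩
    · rw [← hθ, ← hθ, hab]
    · rw [hθ, hq]
      exact ψ.apply_symm_apply _
  exact ⟨AlgEquiv.ofBijective θ hbij, aut_ext c fun a => by
    rw [baseAut_push]
    exact hθ a⟩

end

end Triality

namespace Triality

noncomputable section

variable {F : Type u} [Field F] {S : Type v} [AddCommGroup S] [Module F S] {n : QuadraticForm F S}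
variable {R : Type u} [CommRing R] [Algebra F R]
variable {R₁ : Type u} [CommRing R₁] [Algebra F R₁] {R₂ : Type u} [CommRing R₂] [Algebra F R₂]

/-! ### The triality map on points -/

/-- Locally for the fppf topology, `φ = [f]` and `ψ = [g]` for a triple of similarities. -/
def TripleRel (star : SymmetricComposition n) (φ ψ : AutEnd F S R) : Prop :=
  ∃ (B : Type u) (_ : CommRing B) (_ : Algebra F B) (c : R →ₐ[F] B), IsCover c ∧
    ∃ f g h : Similitude n B, IsClass (baseAut c φ) f ∧ IsClass (baseAut c ψ) g ∧
      Triple star f g h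

theorem TripleRel.base {star : SymmetricComposition n} {φ ψ : AutEnd F S R₁}
    (H : TripleRel star φ ψ) (w : R₁ →ₐ[F] R₂) : TripleRel star (baseAut w φ) (baseAut w ψ) := by
  obtain ⟨B, _, _, c, hc, f, g, h, hf, hg, H⟩ := H
  obtain ⟨B', _, _, c', w', hc', e⟩ := hc.pushout w
  refine ⟨B', _, _, c', hc', f.base w', g.base w', h.base w', ?_, ?_, H.base w'⟩
  · rw [← baseAut_comp, e, baseAut_comp]
    exact hf.base w'
  · rw [← baseAut_comp, e, baseAut_comp]
    exact hg.base w'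

theorem TripleRel.mul {star : SymmetricComposition n} {φ ψ φ' ψ' : AutEnd F S R}
    (H : TripleRel star φ ψ) (H' : TripleRel star φ' ψ') :
    TripleRel star (φ * φ') (ψ * ψ') := by
  obtain ⟨B, _, _, c, hc, f, g, h, hf, hg, H⟩ := H
  obtain ⟨B', _, _, c', hc', f', g', h', hf', hg', H'⟩ := H'
  obtain ⟨B'', _, _, d, d', hd, e⟩ := hc.pushout c'
  refine ⟨B'', _, _, d.comp c', hd.comp hc', _, _, _, ?_, ?_, (H.base d').mul (H'.base d)⟩
  · rw [map_mul]
    refine IsClass.mul ?_ ?_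
    · rw [e, baseAut_comp]
      exact hf.base d'
    · rw [baseAut_comp]
      exact hf'.base d
  · rw [map_mul]
    refine IsClass.mul ?_ ?_
    · rw [e, baseAut_comp]
      exact hg.base d'
    · rw [baseAut_comp]
      exact hg'.base d

theorem TripleRel.trialityRel (hdim : Module.finrank F S = 8) (hn : Nonsingular n)
    {star : SymmetricComposition n} {φ ψ : PGOPlusPoints n R}
    (H : TripleRel star φ.1 ψ.1) : TrialityRel hn star φ ψ := by
  have hfin : FiniteDimensional F S := Module.finite_of_finrank_pos (by omega)
  have hnt : Nontrivial S := Module.nontrivial_of_finrank_pos (R := F) (by omega)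
  obtain ⟨B, _, _, c, hc, f, g, h, hf, hg, H⟩ := H
  exact ⟨B, _, _, c, hc, f, g, h, H.proper hdim hn, (H.rotate hn).proper hdim hn,
    ((H.rotate hn).rotate hn).proper hdim hn, hf, hg, H.diagram⟩

/-- Over a common refinement of the two coverings the class of f determines that of g, and
automorphisms are determined on a covering. -/
theorem TrialityRel.unique (hdim : Module.finrank F S = 8) {hn : Nonsingular n}
    {star : SymmetricComposition n} {φ ψ ψ' : PGOPlusPoints n R}
    (H : TrialityRel hn star φ ψ) (H' : TrialityRel hn star φ ψ') : ψ = ψ' := by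
  have hfin : FiniteDimensional F S := Module.finite_of_finrank_pos (by omega)
  obtain ⟨B, _, _, c, hc, f, g, h, -, -, -, hf, hg, H⟩ := H
  obtain ⟨B', _, _, c', hc', f', g', h', -, -, -, hf', hg', H'⟩ := H'
  obtain ⟨B'', _, _, d, d', hd, e⟩ := hc.pushout c'
  have hf₂ : IsClass (baseAut (d.comp c') φ.1) (f.base d') := by
    rw [e, baseAut_comp]
    exact hf.base d'
  have hg₂ : IsClass (baseAut (d.comp c') ψ.1) (g.base d') := by
    rw [e, baseAut_comp]
    exact hg.base d'
  have hf₃ : IsClass (baseAut (d.comp c') φ.1) (f'.base d) := by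
    rw [baseAut_comp]
    exact hf'.base d
  have hg₃ : IsClass (baseAut (d.comp c') ψ'.1) (g'.base d) := by
    rw [baseAut_comp]
    exact hg'.base d
  have hg₄ := Intertwines.isClass hdim hn (H.intertwines.base d') (H'.intertwines.base d)
    hf₂ hf₃ hg₂
  exact Subtype.ext (baseAut_injective (hd.comp hc') (hg₄.unique hg₃))

/-- Locally g exists over a covering B only. Both pullbacks of f to B ⊗ B represent the same
pullback of φ, so the pullbacks of g have the same class; this is the descent condition for [g]. -/
theorem exists_tripleRel (hdim : Module.finrank F S = 8) (hn : Nonsingular n)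
    (star : SymmetricComposition n) (φ : PGOPlusPoints n R) :
    ∃ ψ : PGOPlusPoints n R, TripleRel star φ.1 ψ.1 := by
  have hfin : FiniteDimensional F S := Module.finite_of_finrank_pos (by omega)
  have hnt : Nontrivial S := Module.nontrivial_of_finrank_pos (R := F) (by omega)
  obtain ⟨φ, B₀, _, _, c₀, hc₀, f₀, hf₀, hφ₀⟩ := φ
  obtain ⟨B, _, _, c₁, hc₁, g, h, H⟩ := hf₀.exists_cover_triple hdim hn star
  let c := c₁.comp c₀
  have hc : IsCover c := hc₁.comp hc₀
  let f := f₀.base c₁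
  have hφ : IsClass (baseAut c φ) f := by
    rw [baseAut_comp]
    exact hφ₀.base c₁
  obtain ⟨D, _, _, i, j, -, hij, hD⟩ := hc.exists_kernel_pair
  have hI : Intertwines star f g.toEquiv := (H.diagram (hn := hn)).intertwines
  have hφi : IsClass (baseAut (i.comp c) φ) (f.base i) := by
    rw [baseAut_comp]
    exact hφ.base i
  have hφj : IsClass (baseAut (i.comp c) φ) (f.base j) := by
    rw [hij, baseAut_comp]
    exact hφ.base j
  have hψ : baseAut i g.aut = baseAut j g.aut :=
    (Intertwines.isClass hdim hn (hI.base i) (hI.base j) hφi hφj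
      ((isClass_aut g).base i)).unique ((isClass_aut g).base j)
  obtain ⟨ψ, hψ'⟩ := exists_baseAut_eq hc hij hD hψ
  have hg : IsClass (baseAut c ψ) g := hψ' ▸ isClass_aut g
  exact ⟨⟨ψ, B, _, _, c, hc, g, (H.rotate hn).proper hdim hn, hg⟩,
    B, _, _, c, hc, f, g, h, hφ, hg, H⟩

theorem existsUnique_trialityRel (hdim : Module.finrank F S = 8) (hn : Nonsingular n)
    (star : SymmetricComposition n) (φ : PGOPlusPoints n R) :
    ∃! ψ : PGOPlusPoints n R, TrialityRel hn star φ ψ := by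
  obtain ⟨ψ, hψ⟩ := exists_tripleRel hdim hn star φ
  exact ⟨ψ, hψ.trialityRel hdim hn, fun ψ' h => h.unique hdim (hψ.trialityRel hdim hn)⟩

theorem TrialityRel.rho_eq (hdim : Module.finrank F S = 8) {hn : Nonsingular n}
    {star : SymmetricComposition n} {φ ψ : PGOPlusPoints n R} (H : TrialityRel hn star φ ψ) :
    rho hn star φ = ψ := by
  have h : ∃ ψ, TrialityRel hn star φ ψ := ⟨ψ, H⟩
  rw [rho, dif_pos h]
  exact h.choose_spec.unique hdim H

theorem tripleRel_rho (hdim : Module.finrank F S = 8) (hn : Nonsingular n)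
    (star : SymmetricComposition n) (φ : PGOPlusPoints n R) :
    TripleRel star φ.1 (rho hn star φ).1 := by
  obtain ⟨ψ, hψ⟩ := exists_tripleRel hdim hn star φ
  rwa [(hψ.trialityRel hdim hn).rho_eq hdim]

theorem rho_mul (hdim : Module.finrank F S = 8) (hn : Nonsingular n)
    (star : SymmetricComposition n) (φ φ' : PGOPlusPoints n R) :
    rho hn star (φ * φ') = rho hn star φ * rho hn star φ' :=
  TrialityRel.rho_eq hdim (TripleRel.trialityRel hdim hn
    ((tripleRel_rho hdim hn star φ).mul (tripleRel_rho hdim hn star φ')))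

theorem rho_map (hdim : Module.finrank F S = 8) (hn : Nonsingular n)
    (star : SymmetricComposition n) (w : R₁ →ₐ[F] R₂) (φ : PGOPlusPoints n R₁) :
    rho hn star (PGOPlusMap n w φ) = PGOPlusMap n w (rho hn star φ) :=
  TrialityRel.rho_eq hdim (TripleRel.trialityRel hdim hn ((tripleRel_rho hdim hn star φ).base w))

theorem Triple.rho_eq (hdim : Module.finrank F S = 8) (hn : Nonsingular n)
    {star : SymmetricComposition n} {f g h : Similitude n R} (H : Triple star f g h)
    {φ ψ : PGOPlusPoints n R} (hφ : IsClass φ.1 f) (hψ : IsClass ψ.1 g) : rho hn star φ = ψ := by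
  refine TrialityRel.rho_eq hdim (TripleRel.trialityRel hdim hn
    ⟨R, _, _, AlgHom.id F R, IsCover.id, f, g, h, ?_, ?_, H⟩)
  · rwa [baseAut_id]
  · rwa [baseAut_id]

/-- The class of a proper similarity. -/
def Similitude.Proper.point [FiniteDimensional F S] {f : Similitude n R} (hf : f.Proper) :
    PGOPlusPoints n R :=
  ⟨f.aut, R, _, _, AlgHom.id F R, IsCover.id, f, hf, by rw [baseAut_id]; exact isClass_aut f⟩

/-- By naturality ρ(φ) can be computed from any triple over any R-algebra, whatever covering was
used to define it. This allows ρ to be iterated on a single covering. -/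
theorem Triple.isClass_rho (hdim : Module.finrank F S = 8) (hn : Nonsingular n)
    {star : SymmetricComposition n} {B : Type u} [CommRing B] [Algebra F B] {c : R →ₐ[F] B}
    {f g h : Similitude n B} (H : Triple star f g h) {φ : PGOPlusPoints n R}
    (hφ : IsClass (baseAut c φ.1) f) : IsClass (baseAut c (rho hn star φ).1) g := by
  have hfin : FiniteDimensional F S := Module.finite_of_finrank_pos (by omega)
  have hnt : Nontrivial S := Module.nontrivial_of_finrank_pos (R := F) (by omega)
  have h₁ := H.rho_eq hdim hn (φ := PGOPlusMap n c φ)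
    (ψ := ((H.rotate hn).proper hdim hn).point) hφ (isClass_aut g)
  rw [rho_map hdim] at h₁
  have h₂ : baseAut c (rho hn star φ).1 = g.aut := congrArg Subtype.val h₁
  rw [h₂]
  exact isClass_aut g

/-- The triples (f, g, h), (g, h, f), (h, f, g) give [f] ↦ [g] ↦ [h] ↦ [f]. -/
theorem rho_rho_rho (hdim : Module.finrank F S = 8) (hn : Nonsingular n)
    (star : SymmetricComposition n) (φ : PGOPlusPoints n R) :
    rho hn star (rho hn star (rho hn star φ)) = φ := by
  have hfin : FiniteDimensional F S := Module.finite_of_finrank_pos (by omega)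
  obtain ⟨B, _, _, c, hc, f, g, h, hf, -, H⟩ := tripleRel_rho hdim hn star φ
  have H₁ := H.rotate hn
  have H₂ := H₁.rotate hn
  exact Subtype.ext (baseAut_injective hc
    ((H₂.isClass_rho hdim hn (H₁.isClass_rho hdim hn (H.isClass_rho hdim hn hf))).unique hf))

/-- As (g, h, f) is a triple for ⋆, (g, f, h) is one for ⋆ᵒᵖ, so [g] ↦ [f]. -/
theorem rho_op_rho (hdim : Module.finrank F S = 8) (hn : Nonsingular n)
    (star : SymmetricComposition n) (φ : PGOPlusPoints n R) :
    rho hn star.op (rho hn star φ) = φ := by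
  have hfin : FiniteDimensional F S := Module.finite_of_finrank_pos (by omega)
  obtain ⟨B, _, _, c, hc, f, g, h, hf, -, H⟩ := tripleRel_rho hdim hn star φ
  exact Subtype.ext (baseAut_injective hc
    (((H.rotate hn).op.isClass_rho hdim hn (H.isClass_rho hdim hn hf)).unique hf))

theorem rho_rho_op (hdim : Module.finrank F S = 8) (hn : Nonsingular n)
    (star : SymmetricComposition n) (φ : PGOPlusPoints n R) :
    rho hn star (rho hn star.op φ) = φ :=
  rho_op_rho hdim hn star.op φ

/-- The triality automorphism of the algebraic group `PGO⁺(n)`. -/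
def trialityAut (hdim : Module.finrank F S = 8) (hn : Nonsingular n)
    (star : SymmetricComposition n) : Aut (PGOPlus n) where
  hom :=
    { app := fun R => GrpCat.ofHom (MonoidHom.mk' (rho hn star) (rho_mul hdim hn star))
      naturality := fun R R' w => GrpCat.hom_ext (MonoidHom.ext fun φ =>
        rho_map hdim hn star w.hom φ) }
  inv :=
    { app := fun R => GrpCat.ofHom (MonoidHom.mk' (rho hn star.op) (rho_mul hdim hn star.op))
      naturality := fun R R' w => GrpCat.hom_ext (MonoidHom.ext fun φ =>
        rho_map hdim hn star.op w.hom φ) }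
  hom_inv_id := by
    ext R φ
    exact rho_op_rho hdim hn star φ
  inv_hom_id := by
    ext R φ
    exact rho_rho_op hdim hn star φ

theorem onPoints_trialityAut (hdim : Module.finrank F S = 8) (hn : Nonsingular n)
    (star : SymmetricComposition n) (φ : PGOPlusPoints n R) :
    onPoints R (trialityAut hdim hn star) φ = rho hn star φ := rfl

theorem trialityAut_pow_three (hdim : Module.finrank F S = 8) (hn : Nonsingular n)
    (star : SymmetricComposition n) : trialityAut hdim hn star ^ 3 = 1 := by
  apply CategoryTheory.Iso.ext
  ext R φ
  rw [pow_succ, pow_succ, pow_one]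
  exact rho_rho_rho hdim hn star φ

theorem IsOuter.ne_one {τ : Aut (PGOPlus n)} (h : IsOuter τ) : τ ≠ 1 := by
  rintro rfl
  refine h F 1 fun R _ _ w φ => ?_
  rw [map_one, one_mul, inv_one, mul_one]
  rfl

end

end Triality

namespace Triality

noncomputable section

variable {F : Type u} [Field F] {S : Type v} [AddCommGroup S] [Module F S] {n : QuadraticForm F S}
variable {R : Type u} [CommRing R] [Algebra F R]

/-! ### Products of two reflections, and outerness -/

/-- The common orthogonal of x and y has dimension at least 6, their span at most 2. -/
theorem exists_orthogonal_notMem_span (hdim : Module.finrank F S = 8) (n : QuadraticForm F S)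
    (x y : S) : ∃ u, QuadraticMap.polar n x u = 0 ∧ QuadraticMap.polar n y u = 0 ∧
      u ∉ Submodule.span F {x, y} := by
  have hfin : FiniteDimensional F S := Module.finite_of_finrank_pos (by omega)
  let T : S →ₗ[F] F × F :=
    (QuadraticMap.polarBilin n x).prod (QuadraticMap.polarBilin n y)
  have h₁ := T.finrank_range_add_finrank_ker
  have h₂ : Module.finrank F (LinearMap.range T) ≤ 2 := by
    refine (Submodule.finrank_le _).trans ?_
    rw [Module.finrank_prod, Module.finrank_self]
  have h₃ : Module.finrank F (Submodule.span F {x, y}) ≤ 2 := by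
    classical
    have := finrank_span_finset_le_card (R := F) ({x, y} : Finset S)
    rw [Finset.coe_pair] at this
    exact this.trans Finset.card_le_two
  by_contra! h
  have h₄ : LinearMap.ker T ≤ Submodule.span F {x, y} := fun u hu =>
    h u (congrArg Prod.fst hu) (congrArg Prod.snd hu)
  have h₅ := Submodule.finrank_mono h₄
  omega

/-- Three anisotropic vectors, the third orthogonal to the independent first two. -/
theorem Nonsingular.exists_vectors (hdim : Module.finrank F S = 8) (hn : Nonsingular n) :
    ∃ x y z : S, n x ≠ 0 ∧ n y ≠ 0 ∧ n z ≠ 0 ∧ QuadraticMap.polar n x z = 0 ∧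
      QuadraticMap.polar n y z = 0 ∧ y ∉ Submodule.span F {x} := by
  have hnt : Nontrivial S := Module.nontrivial_of_finrank_pos (R := F) (by omega)
  have hadd : ∀ u v, n (u + v) = n u + n v + QuadraticMap.polar n u v := fun u v => by
    simp [QuadraticMap.polar]
  obtain ⟨x, hx⟩ := hn.exists_ne_zero
  obtain ⟨y, hy, hxy⟩ : ∃ y, n y ≠ 0 ∧ y ∉ Submodule.span F {x} := by
    obtain ⟨y, hxy, -, hy⟩ := exists_orthogonal_notMem_span hdim n x x
    rw [Set.pair_eq_singleton] at hy
    -- An isotropic y is replaced by x + y, of norm n(x) since b(x, y) = 0.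
    by_cases h : n y = 0
    · refine ⟨x + y, ?_, fun h' => hy ?_⟩
      · rw [hadd, h, hxy, add_zero, add_zero]
        exact hx
      · exact (Submodule.add_mem_iff_right _ (Submodule.mem_span_singleton_self x)).1 h'
    · exact ⟨y, h, hy⟩
  obtain ⟨u, hxu, hyu, hu⟩ := exists_orthogonal_notMem_span hdim n x y
  -- Otherwise b(u, ·) vanishes wherever b(x, ·) and b(y, ·) do, so it is a combination of them, and
  -- u lies in the span of x and y.
  obtain ⟨v, hxv, hyv, huv⟩ : ∃ v, QuadraticMap.polar n x v = 0 ∧ QuadraticMap.polar n y v = 0 ∧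
      QuadraticMap.polar n u v ≠ 0 := by
    by_contra! h
    have h₁ := mem_span_of_iInf_ker_le_ker
      (L := ![QuadraticMap.polarBilin n x, QuadraticMap.polarBilin n y])
      (K := QuadraticMap.polarBilin n u) fun v hv => by
        rw [Submodule.mem_iInf] at hv
        exact h v (hv 0) (hv 1)
    rw [Matrix.range_cons_cons_empty] at h₁
    obtain ⟨a, b, hab⟩ := Submodule.mem_span_pair.1 h₁
    refine hu (Submodule.mem_span_pair.2 ⟨a, b, ?_⟩)
    rw [← sub_eq_zero]
    refine hn _ fun v => ?_
    have h₂ := LinearMap.congr_fun hab v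
    simp only [LinearMap.add_apply, LinearMap.smul_apply, QuadraticMap.polarBilin_apply_apply] at h₂
    rw [QuadraticMap.polar_sub_left, QuadraticMap.polar_add_left, QuadraticMap.polar_smul_left,
      QuadraticMap.polar_smul_left, h₂, sub_self]
  -- One of u, v, u + v is anisotropic, because b(u, v) ≠ 0.
  obtain ⟨z, hz, hxz, hyz⟩ : ∃ z, n z ≠ 0 ∧ QuadraticMap.polar n x z = 0 ∧
      QuadraticMap.polar n y z = 0 := by
    by_cases h₁ : n u = 0
    · by_cases h₂ : n v = 0
      · refine ⟨u + v, ?_, ?_, ?_⟩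
        · rw [hadd, h₁, h₂, zero_add, zero_add]
          exact huv
        · rw [QuadraticMap.polar_add_right, hxu, hxv, add_zero]
        · rw [QuadraticMap.polar_add_right, hyu, hyv, add_zero]
      · exact ⟨v, h₂, hxv, hyv⟩
    · exact ⟨u, h₁, hxu, hyu⟩
  exact ⟨x, y, z, hx, hy, hz, hxz, hyz, hxy⟩

/-- The map `z ↦ b(z, x) x - n(x) z`, a multiple of the reflection in `x`. -/
def reflect (n : QuadraticForm F S) (x : R ⊗[F] S) : Module.End R (R ⊗[F] S) :=
  (QuadraticMap.polarBilin (scalar n R) x).smulRight x - scalar n R x • LinearMap.id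

theorem reflect_apply (x z : R ⊗[F] S) :
    reflect n x z = QuadraticMap.polar (scalar n R) x z • x - scalar n R x • z := by
  simp [reflect]

theorem polar_self_scalar (x : R ⊗[F] S) :
    QuadraticMap.polar (scalar n R) x x = 2 * scalar n R x := by
  rw [QuadraticMap.polar_self, two_smul, two_mul]

theorem reflect_reflect (x z : R ⊗[F] S) :
    reflect n x (reflect n x z) = scalar n R x ^ 2 • z := by
  rw [reflect_apply, reflect_apply, QuadraticMap.polar_sub_right, QuadraticMap.polar_smul_right,
    QuadraticMap.polar_smul_right, polar_self_scalar]
  simp only [smul_eq_mul]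
  module

theorem scalar_reflect (x z : R ⊗[F] S) :
    scalar n R (reflect n x z) = scalar n R x ^ 2 * scalar n R z := by
  have h : ∀ u v, scalar n R (u - v) =
      scalar n R u + scalar n R v - QuadraticMap.polar (scalar n R) u v := fun u v => by
    have h := QuadraticMap.polar_neg_right (Q := scalar n R) u v
    rw [QuadraticMap.polar, QuadraticMap.map_neg, ← sub_eq_add_neg] at h
    linear_combination h
  rw [reflect_apply, h, QuadraticMap.map_smul, QuadraticMap.map_smul, QuadraticMap.polar_smul_left,
    QuadraticMap.polar_smul_right]
  simp only [smul_eq_mul]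
  ring

theorem reflect_of_polar_eq_zero {x z : R ⊗[F] S} (h : QuadraticMap.polar (scalar n R) x z = 0) :
    reflect n x z = -(scalar n R x • z) := by
  rw [reflect_apply, h, zero_smul, zero_sub]

theorem bijective_reflect {x : R ⊗[F] S} (hx : IsUnit (scalar n R x)) :
    Function.Bijective (reflect n x) := by
  refine ⟨fun u v h => ?_, fun u => ⟨((hx.unit⁻¹ : Rˣ) : R) ^ 2 • reflect n x u, ?_⟩⟩
  · have h' := congrArg (reflect n x) h
    rw [reflect_reflect, reflect_reflect] at h'
    exact (hx.pow 2).smul_left_cancel.1 h'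
  · rw [map_smul, reflect_reflect, smul_smul, ← mul_pow, IsUnit.val_inv_mul, one_pow, one_smul]

/-- The reflection in a vector of invertible norm, up to a scalar. -/
def reflectSimilitude {x : R ⊗[F] S} (hx : IsUnit (scalar n R x)) : Similitude n R where
  toEquiv := LinearEquiv.ofBijective (reflect n x) (bijective_reflect hx)
  mult := hx.unit ^ 2
  map_form := fun z => by
    change scalar n R (reflect n x z) = _
    rw [scalar_reflect, Units.val_pow_eq_pow_val, IsUnit.unit_spec]

/-! ### Reflections and the composition -/

theorem SymmetricComposition.mulR_mulR_add (star : SymmetricComposition n) (hn : Nonsingular n)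
    (x y z : R ⊗[F] S) : star.mulR R x (star.mulR R y z) + star.mulR R z (star.mulR R y x) =
      (algebraMap F R star.mult * QuadraticMap.polar (scalar n R) x z) • y := by
  have h := star.mulR_mulR_left hn (x + z) y
  simp only [map_add, LinearMap.add_apply, star.mulR_mulR_left hn] at h
  rw [QuadraticMap.polar]
  linear_combination (norm := module) h

/-- Linearizing x ⋆ (w ⋆ x) = λ n(x) w at w = x ⋆ u gives x ⋆ ((x ⋆ u) ⋆ z) + z ⋆ ((x ⋆ u) ⋆ x) = λ
b(x, z) x ⋆ u, where (x ⋆ u) ⋆ x = λ n(x) u. -/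
theorem SymmetricComposition.reflect_mulR (star : SymmetricComposition n) (hn : Nonsingular n)
    (x z u : R ⊗[F] S) : algebraMap F R star.mult • star.mulR R (reflect n x z) u =
      star.mulR R x (star.mulR R (star.mulR R x u) z) := by
  rw [eq_sub_of_add_eq (star.mulR_mulR_add hn x (star.mulR R x u) z), star.mulR_mulR_right hn,
    reflect_apply, map_sub, LinearMap.sub_apply, map_smul, map_smul, map_smul, LinearMap.smul_apply,
    LinearMap.smul_apply]
  module

theorem SymmetricComposition.mulR_reflect (star : SymmetricComposition n) (hn : Nonsingular n)
    (x z v : R ⊗[F] S) : algebraMap F R star.mult • star.mulR R v (reflect n x z) =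
      star.mulR R (star.mulR R z (star.mulR R v x)) x := by
  have h := star.op.reflect_mulR hn x z v
  simp only [star.mulR_op] at h
  exact h

theorem SymmetricComposition.bijective_mulR_mulR (star : SymmetricComposition n)
    (hn : Nonsingular n) {x y : R ⊗[F] S} (hx : IsUnit (scalar n R x))
    (hy : IsUnit (scalar n R y)) :
    Function.Bijective ((star.mulR R).flip x ∘ₗ star.mulR R y) := by
  rw [LinearMap.coe_comp]
  exact (star.bijective_mulR_right hn hx).comp (star.bijective_mulR_left hn hy)

/-- The map `z ↦ (y ⋆ z) ⋆ x`, which triality attaches to the product of the reflections in `x`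
and `y`. -/
def mulMul (hn : Nonsingular n) (star : SymmetricComposition n) {x y : R ⊗[F] S}
    (hx : IsUnit (scalar n R x)) (hy : IsUnit (scalar n R y)) : (R ⊗[F] S) ≃ₗ[R] (R ⊗[F] S) :=
  LinearEquiv.ofBijective ((star.mulR R).flip x ∘ₗ star.mulR R y)
    (star.bijective_mulR_mulR hn hx hy)

theorem mulMul_apply (hn : Nonsingular n) (star : SymmetricComposition n) {x y : R ⊗[F] S}
    (hx : IsUnit (scalar n R x)) (hy : IsUnit (scalar n R y)) (z : R ⊗[F] S) :
    mulMul hn star hx hy z = star.mulR R (star.mulR R y z) x := rfl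

/-- With f the product of the reflections, g(z) = (y ⋆ z) ⋆ x and h(w) = x ⋆ (w ⋆ y), this reads
f(b) ⋆ g(z) = n(x) n(y) h(b ⋆ z). Each reflection is traded for multiplications by its vector, and
the norm identity removes them again. -/
theorem SymmetricComposition.reflect_reflect_mulR (star : SymmetricComposition n)
    (hn : Nonsingular n) (x y b z : R ⊗[F] S) :
    star.mulR R (reflect n x (reflect n y b)) (star.mulR R (star.mulR R y z) x) =
      (scalar n R x * scalar n R y) • star.mulR R x (star.mulR R (star.mulR R b z) y) := by
  have h := star.mulR_reflect hn y b (star.mulR R y z)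
  rw [star.mulR_mulR_right hn, map_smul, map_smul, LinearMap.smul_apply, mul_smul] at h
  have h := star.isUnit_mult.smul_left_cancel.1 h
  have h' := star.reflect_mulR hn x (reflect n y b) (star.mulR R (star.mulR R y z) x)
  rw [star.mulR_mulR_left hn, map_smul, LinearMap.smul_apply, map_smul, mul_smul, h] at h'
  rw [star.isUnit_mult.smul_left_cancel.1 h', map_smul, smul_smul]

theorem SymmetricComposition.mulR_reflect_reflect (star : SymmetricComposition n)
    (hn : Nonsingular n) (x y w a : R ⊗[F] S) :
    star.mulR R (star.mulR R x (star.mulR R w y)) (reflect n x (reflect n y a)) =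
      (scalar n R x * scalar n R y) • star.mulR R (star.mulR R y (star.mulR R w a)) x := by
  have h := star.op.reflect_reflect_mulR hn x y a w
  simp only [star.mulR_op] at h
  exact h

theorem mul_reflectSimilitude_apply {x y : R ⊗[F] S} (hx : IsUnit (scalar n R x))
    (hy : IsUnit (scalar n R y)) (z : R ⊗[F] S) :
    ((reflectSimilitude hx).mul (reflectSimilitude hy)).toEquiv z =
      reflect n x (reflect n y z) := rfl

theorem intertwines_reflect (hn : Nonsingular n) (star : SymmetricComposition n) {x y : R ⊗[F] S}
    (hx : IsUnit (scalar n R x)) (hy : IsUnit (scalar n R y)) :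
    Intertwines star ((reflectSimilitude hx).mul (reflectSimilitude hy)) (mulMul hn star hx hy) := by
  have hm : ((((reflectSimilitude hx).mul (reflectSimilitude hy)).mult : Rˣ) : R) =
      (scalar n R x * scalar n R y) * (scalar n R x * scalar n R y) := by
    change ((hx.unit ^ 2 * hy.unit ^ 2 : Rˣ) : R) = _
    rw [Units.val_mul, Units.val_pow_eq_pow_val, Units.val_pow_eq_pow_val, IsUnit.unit_spec,
      IsUnit.unit_spec]
    ring
  intro a b z
  rw [hm, mul_smul]
  simp only [mul_reflectSimilitude_apply, mulMul_apply]
  rw [star.reflect_reflect_mulR hn, map_smul, LinearMap.smul_apply, star.mulR_reflect_reflect hn]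

/-- Multiplying by x on the left gives λ n(x) y ⋆ v = c x ⋆ v, and v can be cancelled. So an
eigenvector of invertible norm imposes a linear relation on x and y. -/
theorem SymmetricComposition.smul_eq_smul_of_mulR_mulR (star : SymmetricComposition n)
    (hn : Nonsingular n) {x y v : R ⊗[F] S} (hv : IsUnit (scalar n R v)) {c : R}
    (h : star.mulR R (star.mulR R y v) x = c • v) :
    (algebraMap F R star.mult * scalar n R x) • y = c • x := by
  have h₁ := congrArg (star.mulR R x) h
  rw [star.mulR_mulR_left hn, map_smul] at h₁
  refine (star.bijective_mulR_right hn hv).injective ?_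
  rw [map_smul, map_smul]
  exact h₁

theorem reflect_reflect_one_tmul {x y z : S} (hx : QuadraticMap.polar n x z = 0)
    (hy : QuadraticMap.polar n y z = 0) :
    reflect n ((1 : R) ⊗ₜ[F] x) (reflect n (1 ⊗ₜ y) (1 ⊗ₜ z)) =
      (scalar n R (1 ⊗ₜ x) * scalar n R (1 ⊗ₜ y)) • (1 ⊗ₜ z) := by
  have h : ∀ u : S, QuadraticMap.polar n u z = 0 →
      reflect n ((1 : R) ⊗ₜ[F] u) (1 ⊗ₜ z) = -(scalar n R (1 ⊗ₜ u) • (1 ⊗ₜ z)) := fun u hu =>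
    reflect_of_polar_eq_zero (by rw [polar_scalar_tmul, hu, map_zero, mul_zero])
  rw [h y hy, map_neg, map_smul, h x hx, smul_neg, neg_neg, smul_smul, mul_comm]

theorem not_smul_one_tmul_eq [Nontrivial R] {x y : S} (hxy : y ∉ Submodule.span F {x}) {c d : R}
    (hd : IsUnit d) : d • ((1 : R) ⊗ₜ[F] y) ≠ c • (1 ⊗ₜ x) := by
  intro h
  obtain ⟨l, hly, hlx⟩ := Submodule.exists_dual_map_eq_bot_of_notMem hxy inferInstance
  have hlx' : l x = 0 := by
    have : l x ∈ Submodule.map l (Submodule.span F {x}) :=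
      Submodule.mem_map_of_mem (Submodule.mem_span_singleton_self x)
    rwa [hlx, Submodule.mem_bot] at this
  have h₁ := congrArg (formR R l) h
  rw [map_smul, map_smul, formR_tmul, formR_tmul, hlx', zero_smul, smul_zero,
    hd.smul_eq_zero, Algebra.smul_def, mul_one, map_eq_zero] at h₁
  exact hly h₁

/-- If ρ were conjugation by p, then over a covering where p = [k] the map g(v) = (y ⋆ v) ⋆ x would
be a scalar times k f k⁻¹, with f the product of the reflections in x and y. Since f scales z, k(z)
would be an eigenvector of g of invertible norm, which contradicts the independence of x and y. -/
theorem isOuter_trialityAut (hdim : Module.finrank F S = 8) (hn : Nonsingular n)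
    (star : SymmetricComposition n) : IsOuter (trialityAut hdim hn star) := by
  intro K _ _ p hp
  have hfin : FiniteDimensional F S := Module.finite_of_finrank_pos (by omega)
  have hnt : Nontrivial S := Module.nontrivial_of_finrank_pos (R := F) (by omega)
  obtain ⟨x, y, z, hx, hy, hz, hxz, hyz, hxy⟩ := hn.exists_vectors hdim
  obtain ⟨B, _, _, c, hc, k, -, hk⟩ := p.2
  have hB : Nontrivial B := hc.1.injective.nontrivial
  have hX : IsUnit (scalar n B (1 ⊗ₜ x)) := isUnit_scalar_one_tmul hx
  have hY : IsUnit (scalar n B (1 ⊗ₜ y)) := isUnit_scalar_one_tmul hy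
  obtain ⟨g, h, hg, H⟩ := (intertwines_reflect hn star hX hY).exists_triple hn
  have hfz := mul_reflectSimilitude_apply hX hY (1 ⊗ₜ z)
  rw [reflect_reflect_one_tmul hxz hyz] at hfz
  generalize (reflectSimilitude hX).mul (reflectSimilitude hY) = f at H hfz
  have hψ : IsClass ((H.rotate hn).proper hdim hn).point.1 g := isClass_aut g
  have hφ : IsClass (H.proper hdim hn).point.1 f := isClass_aut f
  have h₁ := hp B c (H.proper hdim hn).point
  rw [onPoints_trialityAut, H.rho_eq hdim hn hφ hψ] at h₁
  rw [h₁] at hψ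
  have h₂ := (hk.mul hφ).mul hk.inv
  obtain ⟨u, hu⟩ := IsClass.exists_smul h₂ hψ
  have hv : IsUnit (scalar n B (k.toEquiv (1 ⊗ₜ z))) := by
    rw [k.map_form]
    exact k.mult.isUnit.mul (isUnit_scalar_one_tmul hz)
  have h₃ := hu (k.toEquiv (1 ⊗ₜ z))
  have h₄ : ((k.mul f).mul k.inv).toEquiv (k.toEquiv (1 ⊗ₜ z)) = k.toEquiv (f.toEquiv (1 ⊗ₜ z)) :=
    congrArg (fun t => k.toEquiv (f.toEquiv t)) (LinearEquiv.symm_apply_apply _ _)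
  rw [h₄, hfz, map_smul, smul_smul, hg, mulMul_apply] at h₃
  exact not_smul_one_tmul_eq hxy (star.isUnit_mult.mul hX)
    (star.smul_eq_smul_of_mulR_mulR hn hv h₃)

theorem orderOf_trialityAut (hdim : Module.finrank F S = 8) (hn : Nonsingular n)
    (star : SymmetricComposition n) : orderOf (trialityAut hdim hn star) = 3 :=
  orderOf_eq_prime (trialityAut_pow_three hdim hn star) (isOuter_trialityAut hdim hn star).ne_one

end

end Triality

theorem mainTheorem5 {F : Type u} [Field F] {S : Type v} [AddCommGroup S] [Module F S]
    (n : QuadraticForm F S) (hdim : Module.finrank F S = 8) (hn : Nonsingular n)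
    (star : SymmetricComposition n) :
    (∀ (R : Type u) [CommRing R] [Algebra F R] (φ : PGOPlusPoints n R),
      ∃! ψ : PGOPlusPoints n R, TrialityRel hn star φ ψ) ∧
    (∀ (R : Type u) [CommRing R] [Algebra F R] (f g h : Similitude n R),
      f.Proper → g.Proper → h.Proper →
      (∃ c : Rˣ, ∀ x y, (c : R) • f.toEquiv (star.mulR R x y) =
        star.mulR R (g.toEquiv x) (h.toEquiv y)) →
      ∀ φ ψ : PGOPlusPoints n R, IsClass φ.1 f → IsClass ψ.1 g → rho hn star φ = ψ) ∧
    ∃ ρ : Aut (PGOPlus n),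
      (∀ (R : Type u) [CommRing R] [Algebra F R] (φ : PGOPlusPoints n R),
        onPoints R ρ φ = rho hn star φ) ∧
      IsOuter ρ ∧ orderOf ρ = 3 ∧
      (∀ (R : Type u) [CommRing R] [Algebra F R] (φ : PGOPlusPoints n R),
        onPoints R ρ⁻¹ φ = rho hn star.op φ) :=
  ⟨fun _ _ _ φ => existsUnique_trialityRel hdim hn star φ,
    fun _ _ _ _ _ _ _ _ _ H _ _ hφ hψ => Triple.rho_eq hdim hn H hφ hψ,
    trialityAut hdim hn star, fun _ _ _ _ => rfl, isOuter_trialityAut hdim hn star,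
    orderOf_trialityAut hdim hn star, fun _ _ _ _ => rfl⟩
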